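/- Let $n\ge 1$ and let $P_1,P_2$ be completely positive maps on $M_n(\mathbb C)$. *Index.* By Stinespring's theorem (Kraus form) a completely positive map $P$ on $M_n(\mathbb C)$ can be written $P(a)=\sum_{r=1}^N t_r a t_r^*$ with $t_r\in M_n(\mathbb C)$; its index $d(P)$ is $\dim_{\mathbb C}\operatorname{span}\{t_1,\dots,t_N\}$. *GNS correspondences.* $E_P=M_n(\mathbb C)\otimes_P M_n(\mathbb C)$ is the algebraic tensor product with left and right multiplication by $M_n(\mathbb C)$ and the $M_n(\mathbb C)$-valued inner product $\langle a\otimes b,a'\otimes b'\rangle=b^*P(a^*a')b'$, modulo null vectors. $E_{P_1P_2}=M_n(\mathbb C)\otimes_{P_1}M_n(\mathbb C)\otimes_{P_2}M_n(\mathbb C)$ is defined in the same way with $$\langle a\otimes b\otimes c,\;a'\otimes b'\otimes c'\rangle=c^*P_2\bigl(b^*P_1(a^*a')b'\bigr)c'.$$ Both are C*-correspondences over $M_n(\mathbb C)$. *Strong Morita equivalence.* A C*-correspondence $E$ over $A$ and a C*-correspondence $F$ over $B$ are strongly Morita equivalent if there is an $A$-$B$ equivalence (imprimitivity) bimodule $X$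 such that the interior tensor products $E\otimes_A X$ and $X\otimes_B F$ are isomorphic as C*-correspondences from $A$ to $B$. *Compression.* For a finite dimensional C*-correspondence $E$ over $M_n(\mathbb C)$ let $F_E=R_n(\mathbb C)\otimes_{M_n(\mathbb C)}E\otimes_{M_n(\mathbb C)}C_n(\mathbb C)$ (interior tensor products), where $R_n(\mathbb C)$ is the row space with inner product $\xi^*\xi'\in M_n(\mathbb C)$ and $C_n(\mathbb C)$ is the column space with inner product $\eta^*\eta'\in\mathbb C$; it is a finite dimensional Hilbert space. Write $F_P=F_{E_P}$ and $F_{P_1P_2}=F_{E_{P_1P_2}}$. **Proposition.** 1. For $i=1,2$ the number $d(P_i)$ does not depend on the representation of $P_i$ used to compute it. 2. $E_{P_1P_2}$ is strongly Morita equivalent to the Hilbert space $\mathbb C^{d(P_1)d(P_2)}$, regarded as a C*-correspondence over $\mathbb C$. 3. $F_{P_1P_2}$ is naturally isomorphic to the Hilbert space tensor product $F_{P_1}\otimes F_{P_2}$: there is a unitary $U:F_{P_1P_2}\to F_{P_1}\otimes F_{P_2}$ such that, with $e_{kl}$ the matrix units, $e_j$ the standard row vectors and $e_i^*$ the standard column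 vectors, $$U\bigl(e_j\otimes(I\otimes e_{kl}\otimes I)\otimes e_i^*\bigr)=\bigl(e_j\otimes(I\otimes I)\otimes e_k^*\bigr)\otimes\bigl(e_l\otimes(I\otimes I)\otimes e_i^*\bigr)$$ for all $i,j,k,l\in\{1,\dots,n\}$. -/

import Mathlib

open scoped TensorProduct ComplexOrder CStarAlgebra
open MulOpposite (op)

noncomputable section

/-! ## Positive matrices over a C*-algebra -/

section PositiveMatrices

variable {A : Type} [CStarAlgebra A] [PartialOrder A] [StarOrderedRing A]

theorem CStarAlgebra.exists_factor {D : Type} [CStarAlgebra D] [PartialOrder D] [StarOrderedRing D]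
    {a : D} (ha : 0 ≤ a) : ∃ b, a = star b * b :=
  CStarAlgebra.nonneg_iff_eq_star_mul_self.mp ha

theorem CStarAlgebra.exists_negPart {D : Type} [CStarAlgebra D] [PartialOrder D]
    [StarOrderedRing D] {a : D} (ha : IsSelfAdjoint a) :
    ∃ p q : D, 0 ≤ p ∧ 0 ≤ q ∧ star q = q ∧ p - q = a ∧ q * a * q = -(q * q * q) ∧
      0 ≤ q * q * q := by
  have hq : 0 ≤ a⁻ := CFC.negPart_nonneg a
  have hs : star a⁻ = a⁻ := (IsSelfAdjoint.of_nonneg hq).star_eq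
  have h := CFC.posPart_sub_negPart a ha
  refine ⟨a⁺, a⁻, CFC.posPart_nonneg a, hq, hs, h, ?_, ?_⟩
  · have : a⁻ * (a⁺ - a⁻) * a⁻ = -(a⁻ * a⁻ * a⁻) := by
      rw [mul_sub, CFC.negPart_mul_posPart]
      simp
    rwa [h] at this
  · have := star_left_conjugate_nonneg hq a⁻
    rwa [hs] at this

theorem CStarMatrix.exists_factor {k : ℕ} {M : CStarMatrix (Fin k) (Fin k) A} (hM : 0 ≤ M) :
    ∃ N : CStarMatrix (Fin k) (Fin k) A, ∀ i j, M i j = ∑ l, star (N l i) * N l j := by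
  obtain ⟨N, rfl⟩ := CStarAlgebra.exists_factor hM
  exact ⟨N, fun i j => by simp [CStarMatrix.mul_apply, CStarMatrix.star_apply]⟩

/-- A self-adjoint matrix `M` over a C*-algebra `A` with `∑ aᵢ* Mᵢⱼ aⱼ ≥ 0` for all `a` in `A^k`
is positive in `M_k(A)`. -/
theorem CStarMatrix.nonneg_of_forall {k : ℕ} (M : CStarMatrix (Fin k) (Fin k) A)
    (hM : ∀ i j, star (M i j) = M j i)
    (h : ∀ a : Fin k → A, 0 ≤ ∑ i, ∑ j, star (a i) * M i j * a j) : 0 ≤ M := by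
  have hsa : IsSelfAdjoint M := by
    ext i j
    simpa [CStarMatrix.star_apply] using hM j i
  obtain ⟨p, N, hp, hN0, hNs, hM', hNM, hC⟩ := CStarAlgebra.exists_negPart hsa
  obtain ⟨S, hS⟩ := CStarMatrix.exists_factor hC
  have hdiag : ∀ j, 0 ≤ (N * M * N) j j := by
    intro j
    have := h (fun i => N i j)
    have e : (N * M * N) j j = ∑ i, ∑ l, star (N i j) * M i l * N l j := by
      have h1 : ∀ i, star (N i j) = N j i := fun i => by
        conv_rhs => rw [← hNs]
        rfl
      simp only [CStarMatrix.mul_apply, h1, Finset.sum_mul]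
      rw [Finset.sum_comm]
    rwa [e]
  have hSz : S = 0 := by
    ext l j
    have h1 : 0 ≤ -∑ l, star (S l j) * S l j := by
      have := hdiag j
      rw [hNM] at this
      rw [← hS]
      exact this
    have h2 : ∑ l, star (S l j) * S l j = 0 :=
      le_antisymm (by simpa using h1) (Finset.sum_nonneg fun l _ => star_mul_self_nonneg _)
    have h3 := (Finset.sum_eq_zero_iff_of_nonneg fun l _ => star_mul_self_nonneg (S l j)).mp h2 l
      (Finset.mem_univ _)
    simpa using CStarRing.star_mul_self_eq_zero_iff _ |>.mp h3
  have hC0 : N * N * N = 0 := by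
    ext i j
    rw [hS]
    simp [hSz]
  have hN2 : N * N = 0 := by
    have : star (N * N) * (N * N) = 0 := by
      rw [star_mul, hNs, ← mul_assoc, hC0, zero_mul]
    exact CStarRing.star_mul_self_eq_zero_iff _ |>.mp this
  have hNz : N = 0 := by
    have : star N * N = 0 := by rw [hNs, hN2]
    exact CStarRing.star_mul_self_eq_zero_iff _ |>.mp this
  rw [← hM', hNz, sub_zero]
  exact hp

end PositiveMatrices

/-! ## C*-correspondences -/

/-- An `A`-`B` bimodule `V` with a `B`-valued semi-inner product (conjugate linear in the first
variable), on which `A` acts by adjointable operators, unitally: a (nondegenerate)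
C*-correspondence from `A` to `B` before null vectors are divided out and the space is completed.
The actions are given as unital algebra homomorphisms into the linear operators on `V`;
`left a v` is `a • v`, and `right (op b) v` is `v • b`. -/
structure PreCorr (A B : Type) [CStarAlgebra A] [CStarAlgebra B] [PartialOrder B]
    [StarOrderedRing B] where
  carrier : Type
  [addCommGroup : AddCommGroup carrier]
  [module : Module ℂ carrier]
  left : A →ₐ[ℂ] Module.End ℂ carrier
  right : Bᵐᵒᵖ →ₐ[ℂ] Module.End ℂ carrier
  form : carrier →ₗ⋆[ℂ] carrier →ₗ[ℂ] B
  left_right : ∀ a b v, left a (right b v) = right b (left a v)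
  form_right : ∀ v w b, form v (right (op b) w) = form v w * b
  form_star : ∀ v w, star (form v w) = form w v
  form_left : ∀ a v w, form (left a v) w = form v (left (star a) w)
  form_nonneg : ∀ v, 0 ≤ form v v

attribute [instance] PreCorr.addCommGroup PreCorr.module

/-- A C*-correspondence from `A` to `B`: a right Hilbert C*-module over `B` (the inner product is
definite, and the norm `‖⟨v, v⟩‖^(1/2)` is complete) with a left action of `A` by adjointable
operators. -/
structure Corr (A B : Type) [CStarAlgebra A] [CStarAlgebra B] [PartialOrder B]
    [StarOrderedRing B] extends PreCorr A B where
  definite : ∀ v, form v v = 0 → v = 0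
  complete : ∀ u : ℕ → carrier,
    (∀ ε > 0, ∃ N, ∀ k ≥ N, ∀ m ≥ N, ‖form (u k - u m) (u k - u m)‖ < ε) →
      ∃ v, ∀ ε > 0, ∃ N, ∀ k ≥ N, ‖form (u k - v) (u k - v)‖ < ε

namespace PreCorr

variable {A B C : Type} [CStarAlgebra A] [CStarAlgebra B] [PartialOrder B]
    [StarOrderedRing B] [CStarAlgebra C] [PartialOrder C] [StarOrderedRing C]

section Basic

variable (V : PreCorr A B)

theorem form_right' (v w : V.carrier) (b : B) :
    V.form (V.right (op b) v) w = star b * V.form v w := by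
  rw [← V.form_star, V.form_right, star_mul, V.form_star]

theorem gram_nonneg {k : ℕ} (v : Fin k → V.carrier) :
    0 ≤ (CStarMatrix.ofMatrix fun i j => V.form (v i) (v j) : CStarMatrix (Fin k) (Fin k) B) := by
  apply CStarMatrix.nonneg_of_forall
  · intro i j
    exact V.form_star _ _
  · intro a
    have := V.form_nonneg (∑ i, V.right (op (a i)) (v i))
    simp only [map_sum, LinearMap.sum_apply, form_right, form_right'] at this
    rw [Finset.sum_comm] at this
    exact this

/-- The Cauchy-Schwarz inequality. -/
theorem norm_form_sq_le (x y : V.carrier) :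
    ‖V.form x y‖ ^ 2 ≤ ‖V.form x x‖ * ‖V.form y y‖ := by
  set z := V.form x y with hz
  have hz' : V.form y x = star z := (V.form_star x y).symm
  have key : ∀ s : ℝ, 0 < s → ‖V.form x x‖ ≤ s → ‖z‖ ^ 2 ≤ s * ‖V.form y y‖ := by
    intro s hs hs'
    have h0 := V.form_nonneg ((s : ℂ) • y - V.right (op z) x)
    have e : V.form ((s : ℂ) • y - V.right (op z) x) ((s : ℂ) • y - V.right (op z) x)
        = s • (s • V.form y y) - s • (star z * z) - s • (star z * z)
          + star z * V.form x x * z := by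
      have h1 : ∀ w, V.form ((s : ℂ) • y) w = s • V.form y w := fun w => by
        rw [LinearMap.map_smulₛₗ, Complex.conj_ofReal, LinearMap.smul_apply, Complex.coe_smul]
      have h2 : ∀ w, V.form w ((s : ℂ) • y) = s • V.form w y := fun w => by
        rw [map_smul, Complex.coe_smul]
      generalize (s : ℂ) • y = y' at h1 h2
      simp only [map_sub, LinearMap.sub_apply, h1, h2, form_right, form_right', hz', ← hz,
        mul_assoc]
      abel
    rw [e] at h0
    have h1 : star z * V.form x x * z ≤ ‖V.form x x‖ • (star z * z) :=
      CStarAlgebra.star_left_conjugate_le_norm_smul (IsSelfAdjoint.of_nonneg (V.form_nonneg x))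
    have h2 : ‖V.form x x‖ • (star z * z) ≤ s • (star z * z) :=
      smul_le_smul_of_nonneg_right hs' (star_mul_self_nonneg z)
    have h3 : s • (star z * z) ≤ s • (s • V.form y y) := by
      rw [← sub_nonneg]
      calc (0 : B) ≤ _ := h0
        _ ≤ s • (s • V.form y y) - s • (star z * z) - s • (star z * z) + s • (star z * z) := by
            gcongr
            exact h1.trans h2
        _ = _ := by abel
    have h4 : star z * z ≤ s • V.form y y := by
      have := smul_le_smul_of_nonneg_left h3 (inv_nonneg.mpr hs.le)
      rwa [smul_smul, smul_smul, inv_mul_cancel₀ hs.ne', one_smul, one_smul] at this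
    have h5 := CStarAlgebra.norm_le_norm_of_nonneg_of_le (star_mul_self_nonneg z) h4
    rwa [CStarRing.norm_star_mul_self, norm_smul, Real.norm_of_nonneg hs.le, ← sq] at h5
  refine le_of_forall_pos_le_add fun ε hε => ?_
  have hd : 0 < ‖V.form y y‖ + 1 := by positivity
  have := key (‖V.form x x‖ + ε / (‖V.form y y‖ + 1)) (by positivity)
    (le_add_of_nonneg_right (by positivity))
  refine this.trans ?_
  rw [add_mul]
  gcongr
  rw [div_mul_eq_mul_div, div_le_iff₀ hd]
  nlinarith [norm_nonneg (V.form y y)]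

theorem form_eq_zero {x : V.carrier} (hx : V.form x x = 0) (y : V.carrier) : V.form x y = 0 := by
  have := V.norm_form_sq_le x y
  rw [hx, norm_zero, zero_mul] at this
  simpa using le_antisymm this (sq_nonneg _)

/-- The null vectors. -/
def null : Submodule ℂ V.carrier where
  carrier := {x | V.form x x = 0}
  zero_mem' := by simp
  add_mem' {x y} hx hy := by
    change V.form _ _ = 0
    simp [V.form_eq_zero hx, V.form_eq_zero hy]
  smul_mem' c x hx := by
    change V.form _ _ = 0
    simp [V.form_eq_zero hx]

theorem form_null {x y : V.carrier} (hy : y ∈ V.null) : V.form x y = 0 := by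
  rw [← V.form_star, V.form_eq_zero hy, star_zero]

theorem left_null (a : A) : V.null ≤ V.null.comap (V.left a) := by
  intro x hx
  change V.form _ _ = 0
  rw [form_left]
  exact V.form_eq_zero hx _

theorem right_null (b : Bᵐᵒᵖ) : V.null ≤ V.null.comap (V.right b) := by
  intro x hx
  change V.form _ (V.right (op b.unop) x) = 0
  rw [form_right, V.form_null hx, zero_mul]

/-- The quotient by the null vectors. -/
def sep : PreCorr A B where
  carrier := V.carrier ⧸ V.null
  left :=
    { toFun := fun a => V.null.mapQ V.null (V.left a) (V.left_null a)
      map_one' := by ext; simp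
      map_mul' := fun a b => by ext; simp
      map_zero' := by ext; simp
      map_add' := fun a b => by ext; simp
      commutes' := fun r => by ext; simp [Algebra.algebraMap_eq_smul_one] }
  right :=
    { toFun := fun a => V.null.mapQ V.null (V.right a) (V.right_null a)
      map_one' := by ext; simp
      map_mul' := fun a b => by ext; simp
      map_zero' := by ext; simp
      map_add' := fun a b => by ext; simp
      commutes' := fun r => by ext; simp [Algebra.algebraMap_eq_smul_one] }
  form := V.null.liftQ
    { toFun := fun v => V.null.liftQ (V.form v) fun _ hy => V.form_null hy
      map_add' := fun v w => by
        ext x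
        exact LinearMap.congr_fun (map_add V.form v w) x
      map_smul' := fun c v => by
        ext x
        exact LinearMap.congr_fun (LinearMap.map_smulₛₗ V.form c v) x }
    fun x hx => by ext y; exact V.form_eq_zero hx y
  left_right a b v := by
    induction v using Submodule.Quotient.induction_on with | H v =>
    exact congrArg _ (V.left_right a b v)
  form_right v w b := by
    induction v using Submodule.Quotient.induction_on with | H v =>
    induction w using Submodule.Quotient.induction_on with | H w =>
    exact V.form_right v w b
  form_star v w := by
    induction v using Submodule.Quotient.induction_on with | H v =>
    induction w using Submodule.Quotient.induction_on with | H w =>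
    exact V.form_star v w
  form_left a v w := by
    induction v using Submodule.Quotient.induction_on with | H v =>
    induction w using Submodule.Quotient.induction_on with | H w =>
    exact V.form_left a v w
  form_nonneg v := by
    induction v using Submodule.Quotient.induction_on with | H v =>
    exact V.form_nonneg v

theorem sep_definite (v : V.sep.carrier) (h : V.sep.form v v = 0) : v = 0 := by
  induction v using Submodule.Quotient.induction_on with | H v =>
  exact (Submodule.Quotient.mk_eq_zero _).mpr h

theorem complete_of_finite [FiniteDimensional ℂ V.carrier]
    (hd : ∀ v, V.form v v = 0 → v = 0) (u : ℕ → V.carrier)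
    (hu : ∀ ε > 0, ∃ N, ∀ k ≥ N, ∀ m ≥ N, ‖V.form (u k - u m) (u k - u m)‖ < ε) :
    ∃ v, ∀ ε > 0, ∃ N, ∀ k ≥ N, ‖V.form (u k - v) (u k - v)‖ < ε := by
  let _ : Norm V.carrier := ⟨fun x => √‖V.form x x‖⟩
  have hdef : ∀ x : V.carrier, ‖x‖ = √‖V.form x x‖ := fun _ => rfl
  have hsq : ∀ x : V.carrier, ‖x‖ ^ 2 = ‖V.form x x‖ := fun x => Real.sq_sqrt (norm_nonneg _)
  have hn : ∀ x : V.carrier, 0 ≤ ‖x‖ := fun x => Real.sqrt_nonneg _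
  have hcs : ∀ x y : V.carrier, ‖V.form x y‖ ≤ ‖x‖ * ‖y‖ := by
    intro x y
    refine (pow_le_pow_iff_left₀ (norm_nonneg _) (mul_nonneg (hn x) (hn y)) two_ne_zero).mp ?_
    rw [mul_pow, hsq, hsq]
    exact V.norm_form_sq_le x y
  have core : NormedSpace.Core ℂ V.carrier :=
    { norm_nonneg := hn
      norm_smul := fun c x => by
        rw [hdef, hdef]
        simp [norm_smul, ← mul_assoc]
      norm_triangle := fun x y => by
        refine (pow_le_pow_iff_left₀ (hn _) (add_nonneg (hn x) (hn y)) two_ne_zero).mp ?_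
        rw [hsq]
        simp only [map_add, LinearMap.add_apply]
        nlinarith [norm_add_le (V.form x x + V.form y x) (V.form x y + V.form y y),
          norm_add_le (V.form x x) (V.form y x), norm_add_le (V.form x y) (V.form y y),
          hcs x y, hcs y x, hsq x, hsq y]
      norm_eq_zero_iff := fun x => by
        rw [hdef, Real.sqrt_eq_zero (norm_nonneg _), norm_eq_zero]
        exact ⟨hd x, fun h => by simp [h]⟩ }
  let _ : NormedAddCommGroup V.carrier := NormedAddCommGroup.ofCore core
  let _ : NormedSpace ℂ V.carrier := NormedSpace.ofCore core
  have : CompleteSpace V.carrier := FiniteDimensional.complete ℂ V.carrier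
  have hc : CauchySeq u := by
    rw [Metric.cauchySeq_iff]
    intro ε hε
    obtain ⟨N, hN⟩ := hu (ε ^ 2) (by positivity)
    refine ⟨N, fun k hk m hm => ?_⟩
    rw [dist_eq_norm]
    have := hN k hk m hm
    rw [← hsq] at this
    exact lt_of_pow_lt_pow_left₀ 2 hε.le this
  obtain ⟨v, hv⟩ := cauchySeq_tendsto_of_complete hc
  refine ⟨v, fun ε hε => ?_⟩
  obtain ⟨N, hN⟩ := Metric.tendsto_atTop.mp hv (√ε) (Real.sqrt_pos.mpr hε)
  refine ⟨N, fun k hk => ?_⟩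
  have := hN k hk
  rw [dist_eq_norm] at this
  rw [← hsq, ← Real.sq_sqrt hε.le]
  exact pow_lt_pow_left₀ this (hn _) two_ne_zero

/-- For a finite dimensional space no completion is needed: dividing by the null vectors gives a
C*-correspondence. -/
def toCorr [FiniteDimensional ℂ V.carrier] : Corr A B where
  toPreCorr := V.sep
  definite := V.sep_definite
  complete :=
    haveI : FiniteDimensional ℂ V.sep.carrier :=
      inferInstanceAs (FiniteDimensional ℂ (V.carrier ⧸ V.null))
    V.sep.complete_of_finite V.sep_definite

end Basic


/-! ### Tensor products -/

/-- A completely positive family of sesquilinear maps: a right `C`-module `W` with a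
`C`-valued form `(w, w') ↦ kernel w b w'` for each `b` in `B`, such that
`∑ kernel wᵢ Mᵢⱼ wⱼ ≥ 0` for positive matrices `M` over `B`. This is what is needed to
equip `V ⊗ W` with the semi-inner product `⟨v ⊗ w, v' ⊗ w'⟩ = kernel w ⟨v, v'⟩ w'`. -/
structure PosKernel (B C : Type) [CStarAlgebra B] [PartialOrder B] [StarOrderedRing B]
    [CStarAlgebra C] [PartialOrder C] [StarOrderedRing C] where
  carrier : Type
  [addCommGroup : AddCommGroup carrier]
  [module : Module ℂ carrier]
  right : Cᵐᵒᵖ →ₐ[ℂ] Module.End ℂ carrier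
  kernel : carrier →ₗ⋆[ℂ] B →ₗ[ℂ] carrier →ₗ[ℂ] C
  kernel_right : ∀ w b w' c, kernel w b (right (op c) w') = kernel w b w' * c
  kernel_star : ∀ w b w', star (kernel w b w') = kernel w' (star b) w
  kernel_nonneg : ∀ (k : ℕ) (M : CStarMatrix (Fin k) (Fin k) B) (w : Fin k → carrier), 0 ≤ M →
    0 ≤ ∑ i, ∑ j, kernel (w i) (M i j) (w j)

attribute [instance] PosKernel.addCommGroup PosKernel.module

section Tensor

variable (V : PreCorr A B) (W : PosKernel B C)

/-- The form determined by `⟨v ⊗ w, v' ⊗ w'⟩ = kernel w ⟨v, v'⟩ w'`. -/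
def kernelForm : (V.carrier ⊗[ℂ] W.carrier) →ₗ⋆[ℂ] (V.carrier ⊗[ℂ] W.carrier) →ₗ[ℂ] C :=
  TensorProduct.lift (LinearMap.mk₂'ₛₗ (starRingEnd ℂ) (starRingEnd ℂ)
    (fun v w => TensorProduct.lift (W.kernel w ∘ₗ V.form v))
    (fun v v' w => by ext; simp)
    (fun c v w => by ext; simp)
    (fun v w w' => by ext; simp)
    (fun c v w => by ext; simp))

theorem kernelForm_tmul (v v' : V.carrier) (w w' : W.carrier) :
    V.kernelForm W (v ⊗ₜ w) (v' ⊗ₜ w') = W.kernel w (V.form v v') w' := by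
  simp [kernelForm]

/-- The algebraic tensor product with the form `⟨v ⊗ w, v' ⊗ w'⟩ = kernel w ⟨v, v'⟩ w'`. -/
def kernelTensor : PreCorr A C where
  carrier := V.carrier ⊗[ℂ] W.carrier
  left := (Module.End.rTensorAlgHom ℂ V.carrier W.carrier).comp V.left
  right := (Module.End.lTensorAlgHom ℂ W.carrier V.carrier).comp W.right
  form := V.kernelForm W
  left_right a b x := by
    induction x with
    | zero => simp
    | add x y hx hy => simp only [map_add, hx, hy]
    | tmul v w => rfl
  form_right x y b := by
    induction x with
    | zero => simp
    | add x y hx hy => simp only [map_add, LinearMap.add_apply, hx, hy, add_mul]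
    | tmul v w =>
      induction y with
      | zero => simp
      | add x y hx hy => simp only [map_add, hx, hy, add_mul]
      | tmul v' w' =>
        refine (V.kernelForm_tmul W v v' w (W.right (op b) w')).trans ?_
        rw [W.kernel_right, kernelForm_tmul]
  form_star x y := by
    induction x with
    | zero => simp
    | add x y hx hy => simp only [map_add, LinearMap.add_apply, hx, hy, star_add]
    | tmul v w =>
      induction y with
      | zero => simp
      | add x y hx hy => simp only [map_add, LinearMap.add_apply, hx, hy, star_add]
      | tmul v w => simp [kernelForm_tmul, W.kernel_star, V.form_star]
  form_left a x y := by
    induction x with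
    | zero => simp
    | add x y hx hy => simp only [map_add, LinearMap.add_apply, hx, hy]
    | tmul v w =>
      induction y with
      | zero => simp
      | add x y hx hy => simp only [map_add, hx, hy]
      | tmul v' w' =>
        refine (V.kernelForm_tmul W (V.left a v) v' w w').trans ?_
        rw [V.form_left, ← kernelForm_tmul]
        rfl
  form_nonneg x := by
    obtain ⟨s, rfl⟩ := TensorProduct.exists_finset x
    let e := s.equivFin
    have h := W.kernel_nonneg s.card _ (fun i => (e.symm i).1.2)
      (V.gram_nonneg fun i => (e.symm i).1.1)
    have hs : ∑ p ∈ s, p.1 ⊗ₜ[ℂ] p.2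
        = ∑ i : Fin s.card, (e.symm i).1.1 ⊗ₜ[ℂ] (e.symm i).1.2 := by
      rw [← Finset.sum_coe_sort, ← e.symm.sum_comp]
    rw [hs]
    simp only [map_sum, LinearMap.sum_apply, kernelForm_tmul]
    rw [Finset.sum_comm]
    exact h

end Tensor

/-- The kernel `⟨w, b • w'⟩` of a correspondence from `B` to `C`. -/
def toKernel (W : PreCorr B C) : PosKernel B C where
  carrier := W.carrier
  right := W.right
  kernel :=
    { toFun := fun w => LinearMap.mk₂ ℂ (fun b w' => W.form w (W.left b w'))
        (fun b b' w => by simp) (fun c b w => by simp) (fun b w w' => by simp)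
        (fun c b w => by simp)
      map_add' := fun w w' => by ext; simp
      map_smul' := fun c w => by ext; simp }
  kernel_right w b w' c := by
    simp [W.left_right, W.form_right]
  kernel_star w b w' := by
    simp [W.form_star, W.form_left]
  kernel_nonneg k M w hM := by
    obtain ⟨N, hN⟩ := CStarMatrix.exists_factor hM
    have h : ∑ i, ∑ j, W.form (w i) (W.left (M i j) (w j))
        = ∑ l, W.form (∑ i, W.left (N l i) (w i)) (∑ i, W.left (N l i) (w i)) := by
      simp only [hN, map_sum, LinearMap.sum_apply, map_mul, Module.End.mul_apply, W.form_left]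
      rw [Finset.sum_comm_cycle]
      refine Finset.sum_congr rfl fun l _ => ?_
      rw [Finset.sum_comm]
    simp only [LinearMap.coe_mk, AddHom.coe_mk, LinearMap.mk₂_apply]
    rw [h]
    exact Finset.sum_nonneg fun l _ => W.form_nonneg _

/-- The algebraic interior tensor product `V ⊗_B W`, with
`⟨v ⊗ w, v' ⊗ w'⟩ = ⟨w, ⟨v, v'⟩ • w'⟩`. The differences `v • b ⊗ w - v ⊗ b • w` are null vectors,
so that dividing by null vectors balances the tensor product over `B`. -/
def tensor (V : PreCorr A B) (W : PreCorr B C) : PreCorr A C :=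
  V.kernelTensor W.toKernel

/-- The elementary tensor `v ⊗ w` in `V ⊗_B W`. -/
def tmul {V : PreCorr A B} {W : PreCorr B C} (v : V.carrier) (w : W.carrier) :
    (V.tensor W).carrier :=
  TensorProduct.tmul ℂ v w

theorem tensor_form_tmul (V : PreCorr A B) (W : PreCorr B C) (v v' : V.carrier)
    (w w' : W.carrier) :
    (V.tensor W).form (tmul v w) (tmul v' w') = W.form w (W.left (V.form v v') w') :=
  V.kernelForm_tmul W.toKernel v v' w w'

/-- The kernel `c* P(b) c'` on `C` of a completely positive map `P : B → C`. -/
def cpKernel (P : B →CP C) : PosKernel B C where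
  carrier := C
  right := Algebra.lsmul ℂ ℂ C
  kernel :=
    { toFun := fun c => LinearMap.mk₂ ℂ (fun b c' => star c * P b * c')
        (fun b b' c => by simp [mul_add, add_mul]) (fun r b c => by simp)
        (fun b c c' => by simp [mul_add]) (fun r b c => by simp)
      map_add' := fun w w' => by ext; simp [add_mul]
      map_smul' := fun r w => by ext; simp }
  kernel_right w b w' c := by
    simp [mul_assoc]
  kernel_star w b w' := by
    simp [mul_assoc, map_star]
  kernel_nonneg k M w hM := by
    obtain ⟨N, hN⟩ := CStarMatrix.exists_factor (P.map_cstarMatrix_nonneg' k M hM)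
    have hN' : ∀ i j, P (M i j) = ∑ l, star (N l i) * N l j := hN
    have h : ∑ i, ∑ j, star (w i) * P (M i j) * w j
        = ∑ l, star (∑ i, N l i * w i) * (∑ i, N l i * w i) := by
      simp only [hN', star_sum, star_mul, Finset.mul_sum, Finset.sum_mul, mul_assoc]
      rw [Finset.sum_comm_cycle]
      refine Finset.sum_congr rfl fun l _ => ?_
      rw [Finset.sum_comm]
    simp only [LinearMap.coe_mk, AddHom.coe_mk, LinearMap.mk₂_apply]
    rw [h]
    exact Finset.sum_nonneg fun l _ => star_mul_self_nonneg _

/-- `V ⊗_P C` for a completely positive map `P : B → C`: the algebraic tensor product with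
`⟨v ⊗ c, v' ⊗ c'⟩ = c* P(⟨v, v'⟩) c'`. -/
def cpTensor (V : PreCorr A B) (P : B →CP C) : PreCorr A C :=
  V.kernelTensor (cpKernel P)

/-- The elementary tensor `v ⊗ c` in `V ⊗_P C`. -/
def cpTmul {V : PreCorr A B} (P : B →CP C) (v : V.carrier) (c : C) : (V.cpTensor P).carrier :=
  TensorProduct.tmul ℂ v (show (cpKernel P).carrier from c)

theorem cpTensor_form_tmul (V : PreCorr A B) (P : B →CP C) (v v' : V.carrier) (c c' : C) :
    (V.cpTensor P).form (cpTmul P v c) (cpTmul P v' c') = star c * P (V.form v v') * c' :=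
  V.kernelForm_tmul (cpKernel P) v v' c c'

/-- A C*-algebra as a correspondence over itself, `⟨a, b⟩ = a* b`. -/
def self (B : Type) [CStarAlgebra B] [PartialOrder B] [StarOrderedRing B] : PreCorr B B where
  carrier := B
  left := Algebra.lmul ℂ B
  right := Algebra.lsmul ℂ ℂ B
  form :=
    { toFun := fun a => LinearMap.mulLeft ℂ (star a)
      map_add' := fun a b => by ext; simp [add_mul]
      map_smul' := fun c a => by ext; simp }
  left_right a b v := by
    simp [mul_assoc]
  form_right v w b := by simp [← mul_assoc]
  form_star v w := by simp
  form_left a v w := by simp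
  form_nonneg v := star_mul_self_nonneg v

end PreCorr

/-! ## Strong Morita equivalence -/

/-- An `A`-`B` equivalence bimodule (imprimitivity bimodule): a right Hilbert C*-module over `B`
on which `A` acts by adjointable operators, with also a left inner product with values in `A`,
`A`-linear in the first variable, for which `B` acts by adjointable operators, such that
`_A⟨x, y⟩ • z = x • ⟨y, z⟩_B`, and with both inner products full. -/
structure EquivBimodule (A B : Type) [CStarAlgebra A] [PartialOrder A] [StarOrderedRing A]
    [CStarAlgebra B] [PartialOrder B] [StarOrderedRing B] extends Corr A B where
  leftForm : carrier →ₗ[ℂ] carrier →ₗ⋆[ℂ] A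
  leftForm_left : ∀ a x y, leftForm (left a x) y = a * leftForm x y
  leftForm_star : ∀ x y, star (leftForm x y) = leftForm y x
  leftForm_right : ∀ b x y,
    leftForm (right (op b) x) y = leftForm x (right (op (star b)) y)
  leftForm_nonneg : ∀ x, 0 ≤ leftForm x x
  leftForm_definite : ∀ x, leftForm x x = 0 → x = 0
  assoc : ∀ x y z, left (leftForm x y) z = right (op (form y z)) x
  full_right : Dense (Submodule.span ℂ {b : B | ∃ x y, form x y = b} : Set B)
  full_left : Dense (Submodule.span ℂ {a : A | ∃ x y, leftForm x y = a} : Set A)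

section Morita

variable {A B : Type} [CStarAlgebra A] [PartialOrder A] [StarOrderedRing A]
  [CStarAlgebra B] [PartialOrder B] [StarOrderedRing B]

/-- `Z` is the Hausdorff completion of `V`: there is a bimodule map from `V` to `Z`
that preserves inner products and has dense range. This determines the correspondence `Z` up to
isomorphism. -/
def PreCorr.IsCompletion (V : PreCorr A B) (Z : Corr A B) : Prop :=
  ∃ j : V.carrier →ₗ[ℂ] Z.carrier,
    (∀ a v, j (V.left a v) = Z.left a (j v)) ∧
    (∀ b v, j (V.right b v) = Z.right b (j v)) ∧
    (∀ v w, Z.form (j v) (j w) = V.form v w) ∧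
    ∀ z, ∀ ε > 0, ∃ v, ‖Z.form (z - j v) (z - j v)‖ < ε

/-- Strong Morita equivalence of a correspondence `E` over `A` and a correspondence `F` over `B`:
for some `A`-`B` equivalence bimodule `X`, the interior tensor products `E ⊗_A X` and `X ⊗_B F`
are isomorphic as correspondences from `A` to `B`. -/
def StronglyMoritaEquivalent (E : Corr A A) (F : Corr B B) : Prop :=
  ∃ (X : EquivBimodule A B) (Z : Corr A B),
    (E.tensor X.toPreCorr).IsCompletion Z ∧ (X.toPreCorr.tensor F.toPreCorr).IsCompletion Z

end Morita

/-! ## Hilbert spaces -/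

/-- A Hilbert space as a correspondence over `ℂ`. -/
def Corr.ofHilbert (H : Type) [NormedAddCommGroup H] [InnerProductSpace ℂ H] [CompleteSpace H] :
    Corr ℂ ℂ where
  carrier := H
  left := Algebra.lsmul ℂ ℂ H
  right := (Algebra.lsmul ℂ ℂ H).comp (AlgEquiv.toOpposite ℂ ℂ).symm.toAlgHom
  form := innerₛₗ ℂ
  left_right a b v := by simp [smul_smul, mul_comm]
  form_right v w b := by simp [mul_comm]
  form_star v w := by simp
  form_left a v w := by simp
  form_nonneg v := by simp
  definite v h := by simpa using h
  complete u hu := by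
    have h : ∀ x : H, ‖innerₛₗ ℂ x x‖ = ‖x‖ ^ 2 := fun x => by simp
    simp only [h] at hu ⊢
    have hc : CauchySeq u := by
      rw [Metric.cauchySeq_iff]
      intro ε hε
      obtain ⟨N, hN⟩ := hu (ε ^ 2) (by positivity)
      refine ⟨N, fun k hk m hm => ?_⟩
      rw [dist_eq_norm]
      exact lt_of_pow_lt_pow_left₀ 2 hε.le (hN k hk m hm)
    obtain ⟨v, hv⟩ := cauchySeq_tendsto_of_complete hc
    refine ⟨v, fun ε hε => ?_⟩
    obtain ⟨N, hN⟩ := Metric.tendsto_atTop.mp hv (√ε) (Real.sqrt_pos.mpr hε)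
    refine ⟨N, fun k hk => ?_⟩
    have := hN k hk
    rw [dist_eq_norm] at this
    rw [← Real.sq_sqrt hε.le]
    exact pow_lt_pow_left₀ this (norm_nonneg _) two_ne_zero

namespace PreCorr

/-- The inner product space `V / {null vectors}` of a semi-inner product space `V`. -/
def Hilb (V : PreCorr ℂ ℂ) : Type := V.sep.carrier

instance (V : PreCorr ℂ ℂ) : AddCommGroup V.Hilb := inferInstanceAs (AddCommGroup V.sep.carrier)

instance (V : PreCorr ℂ ℂ) : Module ℂ V.Hilb := inferInstanceAs (Module ℂ V.sep.carrier)

/-- The inner product of `V.Hilb` is the one of `V`. -/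
abbrev hilbCore (V : PreCorr ℂ ℂ) : InnerProductSpace.Core ℂ V.Hilb where
  inner x y := V.sep.form x y
  conj_inner_symm x y := V.sep.form_star y x
  re_inner_nonneg x := (Complex.nonneg_iff.mp (V.sep.form_nonneg x)).1
  add_left x y z := LinearMap.map_add₂ V.sep.form x y z
  smul_left x y r := LinearMap.map_smulₛₗ₂ V.sep.form r x y
  definite x h := V.sep_definite x h

instance (V : PreCorr ℂ ℂ) : NormedAddCommGroup V.Hilb :=
  @InnerProductSpace.Core.toNormedAddCommGroup ℂ _ _ _ _ V.hilbCore

instance (V : PreCorr ℂ ℂ) : InnerProductSpace ℂ V.Hilb :=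
  @InnerProductSpace.ofCore ℂ _ _ _ _ V.hilbCore.toCore

/-- The class of `v` in `V.Hilb`. -/
def hilbMk (V : PreCorr ℂ ℂ) (v : V.carrier) : V.Hilb := V.null.mkQ v

theorem inner_hilbMk (V : PreCorr ℂ ℂ) (v w : V.carrier) :
    inner ℂ (V.hilbMk v) (V.hilbMk w) = V.form v w := rfl

end PreCorr

/-! ## Completely positive maps on matrix algebras -/

theorem CStarMatrix.ofMatrix_entry {m k A : Type} (M : m → k → A) (i : m) (j : k) :
    (CStarMatrix.ofMatrix M : CStarMatrix m k A) i j = M i j := rfl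

theorem CStarMatrix.sum_entry {m k A ι : Type} [AddCommMonoid A] (s : Finset ι)
    (M : ι → CStarMatrix m k A) (i : m) (j : k) : (∑ x ∈ s, M x) i j = ∑ x ∈ s, M x i j :=
  Matrix.sum_apply i j s M

/-- The C*-algebra `M_n(ℂ)`. -/
abbrev MatAlg (n : ℕ) : Type := CStarMatrix (Fin n) (Fin n) ℂ

instance (n : ℕ) : FiniteDimensional ℂ (MatAlg n) :=
  inferInstanceAs (FiniteDimensional ℂ (Matrix (Fin n) (Fin n) ℂ))

/-- The matrix unit `e_{kl}`. -/
def matUnit {n : ℕ} (k l : Fin n) : MatAlg n := CStarMatrix.ofMatrix (Matrix.single k l 1)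

/-- The column space `C_n(ℂ)`, a correspondence from `M_n(ℂ)` to `ℂ` with `⟨η, η'⟩ = η* η'`. -/
def colSpace (n : ℕ) : PreCorr (MatAlg n) ℂ where
  carrier := Fin n → ℂ
  left := AlgHom.ofLinearMap
    (LinearMap.mk₂ ℂ (fun (a : MatAlg n) (η : Fin n → ℂ) => fun i => ∑ j, a i j * η j)
      (fun a b η => by ext i; simp [add_mul, Finset.sum_add_distrib])
      (fun c a η => by ext i; simp [Finset.mul_sum, mul_assoc])
      (fun a η η' => by ext i; simp [mul_add, Finset.sum_add_distrib])
      (fun c a η => by ext i; simp [Finset.mul_sum, mul_left_comm]))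
    (by
      refine LinearMap.ext fun η => funext fun i => ?_
      simp [CStarMatrix.one_apply])
    (fun a b => by
      refine LinearMap.ext fun η => funext fun i => ?_
      simp only [LinearMap.mk₂_apply, Module.End.mul_apply, CStarMatrix.mul_apply,
        Finset.sum_mul, Finset.mul_sum, mul_assoc]
      exact Finset.sum_comm)
  right := (Algebra.lsmul ℂ ℂ (Fin n → ℂ)).comp (AlgEquiv.toOpposite ℂ ℂ).symm.toAlgHom
  form := LinearMap.mk₂'ₛₗ (starRingEnd ℂ) (RingHom.id ℂ) (fun η η' => ∑ i, star (η i) * η' i)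
    (fun a b η => by simp [add_mul, Finset.sum_add_distrib])
    (fun c a η => by simp [Finset.mul_sum, mul_assoc])
    (fun a η η' => by simp [mul_add, Finset.sum_add_distrib])
    (fun c a η => by simp [Finset.mul_sum, mul_left_comm])
  left_right a b v := by
    refine funext fun i => ?_
    simp [Finset.mul_sum, mul_left_comm]
  form_right v w b := by
    simp [Finset.mul_sum, mul_comm]
  form_star v w := by
    simp [mul_comm]
  form_left a v w := by
    simp only [LinearMap.mk₂'ₛₗ_apply, AlgHom.ofLinearMap_apply, LinearMap.mk₂_apply,
      star_sum, star_mul', Finset.sum_mul, Finset.mul_sum, CStarMatrix.star_apply]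
    rw [Finset.sum_comm]
    refine Finset.sum_congr rfl fun i _ => Finset.sum_congr rfl fun j _ => ?_
    ring
  form_nonneg v := Finset.sum_nonneg fun i _ => star_mul_self_nonneg (v i)

/-- The row space `R_n(ℂ)`, a correspondence from `ℂ` to `M_n(ℂ)` with `⟨ξ, ξ'⟩ = ξ* ξ'`, that is
the matrix with entries `conj ξᵢ * ξ'ⱼ`. -/
def rowSpace (n : ℕ) : PreCorr ℂ (MatAlg n) where
  carrier := Fin n → ℂ
  left := Algebra.lsmul ℂ ℂ (Fin n → ℂ)
  right := AlgHom.ofLinearMap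
    (LinearMap.mk₂ ℂ
      (fun (a : (MatAlg n)ᵐᵒᵖ) (ξ : Fin n → ℂ) => fun j => ∑ i, ξ i * a.unop i j)
      (fun a b η => by ext i; simp [mul_add, Finset.sum_add_distrib])
      (fun c a η => by ext i; simp [Finset.mul_sum, mul_left_comm])
      (fun a η η' => by ext i; simp [add_mul, Finset.sum_add_distrib])
      (fun c a η => by ext i; simp [Finset.mul_sum, mul_assoc]))
    (by
      refine LinearMap.ext fun η => funext fun i => ?_
      simp [CStarMatrix.one_apply])
    (fun a b => by
      refine LinearMap.ext fun η => funext fun i => ?_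
      simp only [LinearMap.mk₂_apply, Module.End.mul_apply, MulOpposite.unop_mul,
        CStarMatrix.mul_apply, Finset.sum_mul, Finset.mul_sum, mul_assoc]
      exact Finset.sum_comm)
  form := LinearMap.mk₂'ₛₗ (starRingEnd ℂ) (RingHom.id ℂ)
    (fun ξ ξ' => (CStarMatrix.ofMatrix fun i j => star (ξ i) * ξ' j : MatAlg n))
    (fun a b η => by ext i j; simp [CStarMatrix.ofMatrix_entry, add_mul])
    (fun c a η => by ext i j; simp [CStarMatrix.ofMatrix_entry, mul_assoc])
    (fun a η η' => by ext i j; simp [CStarMatrix.ofMatrix_entry, mul_add])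
    (fun c a η => by ext i j; simp [CStarMatrix.ofMatrix_entry, mul_left_comm])
  left_right a b v := by
    refine funext fun i => ?_
    simp [Finset.mul_sum]
  form_right v w b := by
    ext i j
    simp [CStarMatrix.ofMatrix_entry, CStarMatrix.mul_apply, Finset.mul_sum, mul_assoc]
  form_star v w := by
    ext i j
    simp [CStarMatrix.ofMatrix_entry, CStarMatrix.star_apply, mul_comm]
  form_left a v w := by
    ext i j
    simp
  form_nonneg v := by
    refine CStarMatrix.nonneg_of_forall _ (fun i j => by simp [CStarMatrix.ofMatrix_entry, mul_comm]) fun a => ?_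
    have h : ∑ i, ∑ j, star (a i) * (star (v i) * v j) * a j
        = star (∑ i, v i * a i) * ∑ i, v i * a i := by
      rw [star_sum, Finset.sum_mul_sum]
      refine Finset.sum_congr rfl fun i _ => Finset.sum_congr rfl fun j _ => ?_
      rw [star_mul']
      ring
    exact h ▸ star_mul_self_nonneg (∑ i, v i * a i)

section CP

variable {n : ℕ}

/-- The GNS correspondence `E_P = M_n ⊗_P M_n` before null vectors are divided out, with
`⟨a ⊗ b, a' ⊗ b'⟩ = b* P(a* a') b'`. -/
def preGNS (P : MatAlg n →CP MatAlg n) : PreCorr (MatAlg n) (MatAlg n) :=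
  (PreCorr.self (MatAlg n)).cpTensor P

/-- `M_n ⊗_{P₁} M_n ⊗_{P₂} M_n` before null vectors are divided out, with
`⟨a ⊗ b ⊗ c, a' ⊗ b' ⊗ c'⟩ = c* P₂(b* P₁(a* a') b') c'`. -/
def preGNS₂ (P₁ P₂ : MatAlg n →CP MatAlg n) : PreCorr (MatAlg n) (MatAlg n) :=
  (preGNS P₁).cpTensor P₂

/-- The elementary tensor `a ⊗ b`. -/
def preGNS.tmul (P : MatAlg n →CP MatAlg n) (a b : MatAlg n) : (preGNS P).carrier :=
  PreCorr.cpTmul (V := PreCorr.self (MatAlg n)) P a b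

/-- The elementary tensor `a ⊗ b ⊗ c`. -/
def preGNS₂.tmul (P₁ P₂ : MatAlg n →CP MatAlg n) (a b c : MatAlg n) : (preGNS₂ P₁ P₂).carrier :=
  PreCorr.cpTmul (V := preGNS P₁) P₂ (preGNS.tmul P₁ a b) c

theorem preGNS_form_tmul (P : MatAlg n →CP MatAlg n) (a b a' b' : MatAlg n) :
    (preGNS P).form (preGNS.tmul P a b) (preGNS.tmul P a' b') = star b * P (star a * a') * b' :=
  PreCorr.cpTensor_form_tmul (PreCorr.self (MatAlg n)) P a a' b b'

theorem preGNS₂_form_tmul (P₁ P₂ : MatAlg n →CP MatAlg n) (a b c a' b' c' : MatAlg n) :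
    (preGNS₂ P₁ P₂).form (preGNS₂.tmul P₁ P₂ a b c) (preGNS₂.tmul P₁ P₂ a' b' c')
      = star c * P₂ (star b * P₁ (star a * a') * b') * c' :=
  (PreCorr.cpTensor_form_tmul (preGNS P₁) P₂ _ _ c c').trans (by rw [preGNS_form_tmul])

instance (P : MatAlg n →CP MatAlg n) : FiniteDimensional ℂ (preGNS P).carrier :=
  inferInstanceAs (FiniteDimensional ℂ (MatAlg n ⊗[ℂ] MatAlg n))

instance (P₁ P₂ : MatAlg n →CP MatAlg n) : FiniteDimensional ℂ (preGNS₂ P₁ P₂).carrier :=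
  inferInstanceAs (FiniteDimensional ℂ ((MatAlg n ⊗[ℂ] MatAlg n) ⊗[ℂ] MatAlg n))

/-- The GNS correspondence `E_P = M_n ⊗_P M_n`. -/
def gns (P : MatAlg n →CP MatAlg n) : Corr (MatAlg n) (MatAlg n) := (preGNS P).toCorr

/-- The iterated GNS correspondence `M_n ⊗_{P₁} M_n ⊗_{P₂} M_n`. -/
def gns₂ (P₁ P₂ : MatAlg n →CP MatAlg n) : Corr (MatAlg n) (MatAlg n) := (preGNS₂ P₁ P₂).toCorr

/-- The class of `a ⊗ b` in `E_P`. -/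
def gns.mk (P : MatAlg n →CP MatAlg n) (a b : MatAlg n) : (gns P).carrier :=
  (preGNS P).null.mkQ (preGNS.tmul P a b)

/-- The class of `a ⊗ b ⊗ c` in `M_n ⊗_{P₁} M_n ⊗_{P₂} M_n`. -/
def gns₂.mk (P₁ P₂ : MatAlg n →CP MatAlg n) (a b c : MatAlg n) : (gns₂ P₁ P₂).carrier :=
  (preGNS₂ P₁ P₂).null.mkQ (preGNS₂.tmul P₁ P₂ a b c)

/-- The compression `R_n ⊗_{M_n} E ⊗_{M_n} C_n` of a finite dimensional correspondence `E` over
`M_n(ℂ)`, a finite dimensional Hilbert space. -/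
def Compression (E : Corr (MatAlg n) (MatAlg n)) : Type :=
  (((rowSpace n).tensor E.toPreCorr).tensor (colSpace n)).Hilb

instance (E : Corr (MatAlg n) (MatAlg n)) : NormedAddCommGroup (Compression E) :=
  inferInstanceAs (NormedAddCommGroup (PreCorr.Hilb _))

instance (E : Corr (MatAlg n) (MatAlg n)) : InnerProductSpace ℂ (Compression E) :=
  inferInstanceAs (InnerProductSpace ℂ (PreCorr.Hilb _))

/-- The class of `ξ ⊗ x ⊗ η` in the compression. -/
def Compression.mk (E : Corr (MatAlg n) (MatAlg n)) (ξ : Fin n → ℂ) (x : E.carrier)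
    (η : Fin n → ℂ) : Compression E :=
  PreCorr.hilbMk _ (PreCorr.tmul (V := (rowSpace n).tensor E.toPreCorr) (W := colSpace n)
    (PreCorr.tmul (V := rowSpace n) (W := E.toPreCorr) ξ x) η)

/-- `P(a) = ∑ t_r a t_r*` for all `a`. -/
def IsKraus (P : MatAlg n →CP MatAlg n) {N : ℕ} (t : Fin N → MatAlg n) : Prop :=
  ∀ a, P a = ∑ r, t r * a * star (t r)

theorem exists_isKraus (P : MatAlg n →CP MatAlg n) :
    ∃ (N : ℕ) (t : Fin N → MatAlg n), IsKraus P t := by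
  rcases Nat.eq_zero_or_pos n with rfl | hn
  · exact ⟨0, fun _ => 0, fun a => by ext i; exact i.elim0⟩
  let z : Fin n := ⟨0, hn⟩
  have hE : 0 ≤ (CStarMatrix.ofMatrix fun i j => matUnit i j :
      CStarMatrix (Fin n) (Fin n) (MatAlg n)) := by
    refine CStarMatrix.nonneg_of_forall _ (fun i j => ?_) fun a => ?_
    · ext p q
      simp [CStarMatrix.ofMatrix_entry, matUnit, CStarMatrix.star_apply, Matrix.single_apply,
        and_comm, apply_ite]
    · have h : ∑ i, ∑ j, star (a i) * matUnit i j * a j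
          = star (∑ i, matUnit z i * a i) * ∑ i, matUnit z i * a i := by
        rw [star_sum, Finset.sum_mul_sum]
        refine Finset.sum_congr rfl fun i _ => Finset.sum_congr rfl fun j _ => ?_
        have hs : star (matUnit z i) = matUnit i z := by
          ext p q
          simp [matUnit, CStarMatrix.star_apply, Matrix.single_apply, and_comm, apply_ite]
        have hm : matUnit i z * matUnit z j = matUnit i j := by
          have := Matrix.single_mul_single_same (c := (1 : ℂ)) i z j 1
          rw [mul_one] at this
          exact this
        rw [star_mul, hs, ← hm]
        simp only [mul_assoc]
      exact h ▸ star_mul_self_nonneg _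
  obtain ⟨N, hN⟩ := CStarMatrix.exists_factor (P.map_cstarMatrix_nonneg' n _ hE)
  have hN' : ∀ i j, P (matUnit i j) = ∑ l, star (N l i) * N l j := hN
  let e := Fintype.equivFin (Fin n × Fin n)
  let s : Fin n × Fin n → MatAlg n := fun x =>
    CStarMatrix.ofMatrix fun p i => star (N x.1 i x.2 p)
  refine ⟨_, fun r => s (e.symm r), fun a => ?_⟩
  rw [e.symm.sum_comp (fun x => s x * a * star (s x))]
  have ha : a = ∑ i, ∑ j, a i j • matUnit i j := by
    refine (Matrix.matrix_eq_sum_single (CStarMatrix.ofMatrix.symm a)).trans ?_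
    refine Finset.sum_congr rfl fun i _ => Finset.sum_congr rfl fun j _ => ?_
    ext p q
    simp [matUnit, Matrix.single_apply]
  have hP : P a = ∑ i, ∑ j, a i j • P (matUnit i j) := by
    conv_lhs => rw [ha]
    simp only [map_sum, map_smul]
  rw [hP]
  ext p q
  simp only [s, hN', CStarMatrix.sum_entry, CStarMatrix.smul_apply, CStarMatrix.mul_apply,
    CStarMatrix.star_apply, CStarMatrix.ofMatrix_entry, star_star, Finset.sum_mul,
    Finset.smul_sum, smul_eq_mul, Fintype.sum_prod_type]
  simp only [Finset.mul_sum]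
  rw [Finset.sum_comm_cycle]
  refine Finset.sum_congr rfl fun l _ => ?_
  rw [Finset.sum_comm_cycle]
  refine Finset.sum_congr rfl fun m _ => ?_
  rw [Finset.sum_comm]
  refine Finset.sum_congr rfl fun j _ => Finset.sum_congr rfl fun i _ => ?_
  ring

/-- The index `d(P)`: the dimension of the linear span of the operators `t_r` in a representation
`P(a) = ∑ t_r a t_r*`. -/
def cpIndex (P : MatAlg n →CP MatAlg n) : ℕ :=
  Module.finrank ℂ (Submodule.span ℂ (Set.range (exists_isKraus P).choose_spec.choose))

end CP

end

/-! Let `T` be the `n² × N` matrix whose columns are the Kraus operators `t_r`. The relation `P(a) =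
∑ t_r a t_r*` says exactly that `T T*` is the Choi matrix of `P`, so `dim span {t_r} = rank T = rank
(T T*)` is determined by `P`. Replacing the rows of `T` by their coordinates in an orthonormal basis
of the row space keeps `T T*`, and gives a Kraus family of length `d(P)` whose rows span `ℂ^d(P)`
(`exists_isKraus_span_row`).

For such a family `a ⊗ b ↦ (a t_r* b)_r` preserves inner products, and it is onto because the rows
span (`cpCoord_surjective`). Hence `E_P` is `M_n(ℂ)^d(P)` as a bimodule. The same map applied twice,
`a ⊗ b ⊗ c ↦ (a t_r* b u_s* c)_{r,s}`, identifies `E_{P₁P₂}` with a sum of `d(P₁) d(P₂)` copies of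
`M_n(ℂ)`.

Everything else concerns `M_n(ℂ)^ι`: the column space implements its Morita equivalence with `ℂ^ι`,
and its compression is `ℂ^ι` through `ξ ⊗ x ⊗ η ↦ (ξ x_r η)_r`. In these coordinates the formula for
`U` reads `e_j t_r* e_{kl} u_s* e_i* = (e_j t_r* e_k*)(e_l u_s* e_i*)`. -/

noncomputable section

/-! ### Kraus families, the Choi matrix and minimal families. -/

section Kraus

variable {n : ℕ} {P : MatAlg n →CP MatAlg n}

theorem matUnit_entry (k l p q : Fin n) :
    matUnit k l p q = if k = p ∧ l = q then (1 : ℂ) else 0 :=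
  Matrix.single_apply _ _ _ _ _

/-- The matrix with columns `t_r`, whose product with its adjoint is the Choi matrix. -/
def krausMatrix {N : ℕ} (t : Fin N → MatAlg n) : Matrix (Fin n × Fin n) (Fin N) ℂ :=
  Matrix.of fun p r => t r p.1 p.2

/-- Both sides of the Kraus relation are linear in `a`, so matrix units suffice, and `s e_{ij} s*`
has rank-one entries. -/
theorem isKraus_iff_entries {N : ℕ} {t : Fin N → MatAlg n} :
    IsKraus P t ↔ ∀ i j p q, P (matUnit i j) p q = ∑ r, t r p i * star (t r q j) := by
  have he : ∀ i j p q (s : MatAlg n), (s * matUnit i j * star s) p q = s p i * star (s q j) := by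
    intro i j p q s
    simp [CStarMatrix.mul_apply, CStarMatrix.star_apply, matUnit_entry, ite_and]
  refine ⟨fun h i j p q => ?_, fun h a => ?_⟩
  · rw [h, CStarMatrix.sum_entry]
    exact Finset.sum_congr rfl fun r _ => he _ _ _ _ _
  · have ha : a = ∑ i, ∑ j, a i j • matUnit i j := by
      ext p q
      simp only [CStarMatrix.sum_entry, CStarMatrix.smul_apply, matUnit_entry]
      simp [ite_and]
    have hu : ∀ i j, P (matUnit i j) = ∑ r, t r * matUnit i j * star (t r) := by
      intro i j
      ext p q
      rw [h, CStarMatrix.sum_entry]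
      exact Finset.sum_congr rfl fun r _ => (he _ _ _ _ _).symm
    rw [ha]
    simp only [map_sum, map_smul, hu, Finset.mul_sum, Finset.sum_mul, Finset.smul_sum,
      mul_smul_comm, smul_mul_assoc]
    rw [Finset.sum_comm_cycle]

/-- The right side involves `P` alone, so two matrices represent the same `P` exactly when their
rows have the same Gram matrix. -/
theorem isKraus_iff_choi {N : ℕ} {t : Fin N → MatAlg n} :
    IsKraus P t ↔ krausMatrix t * (krausMatrix t).conjTranspose =
      Matrix.of fun x y => P (matUnit x.2 y.2) x.1 y.1 := by
  rw [isKraus_iff_entries]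
  refine ⟨fun h => ?_, fun h i j p q => ?_⟩
  · ext x y
    exact (h x.2 y.2 x.1 y.1).symm
  · exact (congrFun (congrFun h (p, i)) (q, j)).symm

/-- The columns are the `t_r` written as vectors, and this rewriting is linear and injective. -/
theorem rank_krausMatrix {N : ℕ} (t : Fin N → MatAlg n) :
    (krausMatrix t).rank = Module.finrank ℂ (Submodule.span ℂ (Set.range t)) := by
  rw [Matrix.rank_eq_finrank_span_cols]
  let f : MatAlg n →ₗ[ℂ] (Fin n × Fin n → ℂ) :=
    { toFun := fun a p => a p.1 p.2
      map_add' := fun _ _ => rfl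
      map_smul' := fun _ _ => rfl }
  have hf : Function.Injective f := fun a b h => by
    ext i j
    exact congrFun h (i, j)
  have hr : Set.range (krausMatrix t).col = f '' Set.range t := by
    rw [← Set.range_comp]
    rfl
  rw [hr, ← Submodule.map_span]
  exact (Submodule.equivMapOfInjective f hf _).finrank_eq.symm

/-- Both dimensions equal the rank of the Choi matrix, since `T` and `T T*` have the same rank. -/
theorem IsKraus.finrank_span_eq {N N' : ℕ} {t : Fin N → MatAlg n} {s : Fin N' → MatAlg n}
    (ht : IsKraus P t) (hs : IsKraus P s) :
    Module.finrank ℂ (Submodule.span ℂ (Set.range t)) =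
      Module.finrank ℂ (Submodule.span ℂ (Set.range s)) := by
  rw [← rank_krausMatrix, ← rank_krausMatrix, ← Matrix.rank_self_mul_conjTranspose,
    isKraus_iff_choi.mp ht, ← isKraus_iff_choi.mp hs, Matrix.rank_self_mul_conjTranspose]

theorem IsKraus.finrank_span_eq_cpIndex {N : ℕ} {t : Fin N → MatAlg n} (ht : IsKraus P t) :
    Module.finrank ℂ (Submodule.span ℂ (Set.range t)) = cpIndex P :=
  ht.finrank_span_eq (exists_isKraus P).choose_spec.choose_spec

/-- There is a Kraus family of length `d(P)` whose matrix has rows spanning `ℂ^d(P)`. -/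
theorem exists_isKraus_span_row (P : MatAlg n →CP MatAlg n) :
    ∃ t : Fin (cpIndex P) → MatAlg n, IsKraus P t ∧
      Submodule.span ℂ (Set.range (krausMatrix t).row) = ⊤ := by
  obtain ⟨N, t, ht⟩ := exists_isKraus P
  let x : Fin n × Fin n → EuclideanSpace ℂ (Fin N) := fun p => WithLp.toLp 2 ((krausMatrix t).row p)
  let W := Submodule.span ℂ (Set.range x)
  let y : Fin n × Fin n → W := fun p => ⟨x p, Submodule.subset_span ⟨p, rfl⟩⟩
  let w := stdOrthonormalBasis ℂ W
  let s : Fin (Module.finrank ℂ W) → MatAlg n := fun r =>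
    CStarMatrix.ofMatrix fun i j => w.repr (y (i, j)) r
  have hs : IsKraus P s := by
    rw [isKraus_iff_choi, ← isKraus_iff_choi.mp ht]
    ext p q
    -- Coordinates in an orthonormal basis preserve the inner products of rows, which are the
    -- entries of `T T*`. The order is `q, p` because the inner product is conjugate linear in its
    -- first variable.
    have h1 := w.repr.inner_map_map (y q) (y p)
    have h2 : inner ℂ (y q) (y p) = inner ℂ (x q) (x p) := rfl
    rw [h2, PiLp.inner_apply, PiLp.inner_apply] at h1
    simpa [Matrix.mul_apply, krausMatrix, s, x, CStarMatrix.ofMatrix_entry] using h1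
  have hspan : Submodule.span ℂ (Set.range (krausMatrix s).row) = ⊤ := by
    have hy : Submodule.span ℂ (Set.range y) = ⊤ := by
      have h := Submodule.span_span_coe_preimage (R := ℂ) (s := Set.range x)
      rw [← h]
      congr 1
      ext z
      constructor
      · rintro ⟨p, rfl⟩
        exact ⟨p, rfl⟩
      · rintro ⟨p, hp⟩
        exact ⟨p, Subtype.ext hp⟩
    -- The vectors `y` span `W` by construction, and the coordinate isomorphism carries them to the
    -- new rows.
    let g := w.repr.toLinearEquiv.trans (WithLp.linearEquiv 2 ℂ (Fin (Module.finrank ℂ W) → ℂ))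
    have hr : Set.range (krausMatrix s).row = g.toLinearMap '' Set.range y := by
      rw [← Set.range_comp]
      rfl
    rw [hr, ← Submodule.map_span, hy, Submodule.map_top, LinearEquiv.range]
  -- Row rank equals column rank, and the rows of the new matrix span the whole coordinate space.
  have hd : Module.finrank ℂ W = cpIndex P := by
    rw [← hs.finrank_span_eq_cpIndex, ← rank_krausMatrix, Matrix.rank_eq_finrank_span_row, hspan]
    simp
  -- The length is made a variable so that the equality `hd` can be eliminated although the type of
  -- `s` depends on it.
  have key : ∀ d, d = cpIndex P → (∃ s : Fin d → MatAlg n, IsKraus P s ∧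
      Submodule.span ℂ (Set.range (krausMatrix s).row) = ⊤) →
      ∃ t : Fin (cpIndex P) → MatAlg n, IsKraus P t ∧
        Submodule.span ℂ (Set.range (krausMatrix t).row) = ⊤ := by
    rintro d rfl h
    exact h
  exact key _ hd ⟨s, hs, hspan⟩

end Kraus

/-! ### Coordinates identifying a correspondence with a sum of copies of `M_n(ℂ)`. -/

section Coordinates

theorem PreCorr.cpTensor_induction {A B C : Type} [CStarAlgebra A] [CStarAlgebra B]
    [PartialOrder B] [StarOrderedRing B] [CStarAlgebra C] [PartialOrder C] [StarOrderedRing C]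
    {V : PreCorr A B} {P : B →CP C} {p : (V.cpTensor P).carrier → Prop}
    (x : (V.cpTensor P).carrier) (zero : p 0) (tmul : ∀ v c, p (PreCorr.cpTmul P v c))
    (add : ∀ x y, p x → p y → p (x + y)) : p x :=
  TensorProduct.induction_on x zero tmul add

theorem PreCorr.tensor_induction {A B C : Type} [CStarAlgebra A] [CStarAlgebra B]
    [PartialOrder B] [StarOrderedRing B] [CStarAlgebra C] [PartialOrder C] [StarOrderedRing C]
    {V : PreCorr A B} {W : PreCorr B C} {p : (V.tensor W).carrier → Prop}
    (x : (V.tensor W).carrier) (zero : p 0) (tmul : ∀ v w, p (PreCorr.tmul v w))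
    (add : ∀ x y, p x → p y → p (x + y)) : p x :=
  TensorProduct.induction_on x zero tmul add

variable {n : ℕ}

/-- An identification, up to null vectors, of a correspondence over `M_n(ℂ)` with the direct sum
of copies of `M_n(ℂ)` indexed by `ι`. -/
structure MatrixCoords (V : PreCorr (MatAlg n) (MatAlg n)) (ι : Type) [Fintype ι] where
  coord : V.carrier →ₗ[ℂ] (ι → MatAlg n)
  coord_left : ∀ a v r, coord (V.left a v) r = a * coord v r
  coord_right : ∀ a v r, coord (V.right (op a) v) r = coord v r * a
  form_eq : ∀ v w, V.form v w = ∑ r, star (coord v r) * coord w r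
  surjective : Function.Surjective coord

namespace MatrixCoords

variable {V : PreCorr (MatAlg n) (MatAlg n)} {ι κ : Type} [Fintype ι] [Fintype κ]

/-- The coordinates of `M_n(ℂ)` as a correspondence over itself. -/
def self (n : ℕ) : MatrixCoords (PreCorr.self (MatAlg n)) Unit where
  coord :=
    { toFun := fun a _ => a
      map_add' := fun _ _ => rfl
      map_smul' := fun _ _ => rfl }
  coord_left _ _ _ := rfl
  coord_right _ _ _ := rfl
  form_eq v w := by
    rw [Fintype.sum_unique]
    rfl
  surjective f := ⟨f (), rfl⟩

/-- Renaming the indices. -/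
def reindex (Φ : MatrixCoords V ι) (e : κ ≃ ι) : MatrixCoords V κ where
  coord := (LinearMap.funLeft ℂ (MatAlg n) e).comp Φ.coord
  coord_left a v r := Φ.coord_left a v (e r)
  coord_right a v r := Φ.coord_right a v (e r)
  form_eq v w := (Φ.form_eq v w).trans
    (e.sum_comp fun r => star (Φ.coord v r) * Φ.coord w r).symm
  surjective := (LinearMap.funLeft_surjective_of_injective ℂ (MatAlg n) e e.injective).comp
    Φ.surjective

/-- The coordinates of the quotient by the null vectors. -/
def sep (Φ : MatrixCoords V ι) : MatrixCoords V.sep ι where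
  coord := V.null.liftQ Φ.coord (by
    intro x hx
    have h : ∑ r, star (Φ.coord x r) * Φ.coord x r = 0 := (Φ.form_eq x x).symm.trans hx
    rw [LinearMap.mem_ker]
    funext r
    -- A vanishing sum of positive elements `x_r* x_r` forces each `x_r = 0`, so null vectors have
    -- zero coordinates.
    have h' := (Finset.sum_eq_zero_iff_of_nonneg
      fun r _ => star_mul_self_nonneg (Φ.coord x r)).mp h r (Finset.mem_univ r)
    exact (CStarRing.star_mul_self_eq_zero_iff _).mp h')
  coord_left a v r := by
    induction v using Submodule.Quotient.induction_on with | H v =>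
    exact Φ.coord_left a v r
  coord_right a v r := by
    induction v using Submodule.Quotient.induction_on with | H v =>
    exact Φ.coord_right a v r
  form_eq v w := by
    induction v using Submodule.Quotient.induction_on with | H v =>
    induction w using Submodule.Quotient.induction_on with | H w =>
    exact Φ.form_eq v w
  surjective f := by
    obtain ⟨x, hx⟩ := Φ.surjective f
    exact ⟨V.null.mkQ x, hx⟩

section CPTensor

variable {P : MatAlg n →CP MatAlg n} {N : ℕ} {t : Fin N → MatAlg n}

/-- The map `v ⊗ c ↦ (v_r t_s* c)_{r,s}`. -/
def cpCoord (Φ : MatrixCoords V ι) (P : MatAlg n →CP MatAlg n) (t : Fin N → MatAlg n) :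
    (V.cpTensor P).carrier →ₗ[ℂ] (ι × Fin N → MatAlg n) :=
  show (V.carrier ⊗[ℂ] MatAlg n) →ₗ[ℂ] (ι × Fin N → MatAlg n) from TensorProduct.lift
    (LinearMap.mk₂ ℂ (fun v c rs => Φ.coord v rs.1 * star (t rs.2) * c)
    (fun v w c => by ext1 rs; simp [add_mul])
    (fun z v c => by ext1 rs; simp)
    (fun v c c' => by ext1 rs; simp [mul_add])
    (fun z v c => by ext1 rs; simp))

theorem cpCoord_tmul (Φ : MatrixCoords V ι) (P : MatAlg n →CP MatAlg n) (t : Fin N → MatAlg n) (v : V.carrier)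
    (c : MatAlg n) (rs : ι × Fin N) :
    Φ.cpCoord P t (PreCorr.cpTmul P v c) rs = Φ.coord v rs.1 * star (t rs.2) * c := rfl

/-- Since `e_{ip} t_s* e_{qj} = conj((t_s)_{qp}) e_{ij}`, suitable elementary tensors have in block
`r` the coordinates `conj(row (q, p))` times `e_{ij}`, and zero in the other blocks. Spanning rows
therefore isolate every single slot `(r, s)`. -/
theorem cpCoord_surjective (Φ : MatrixCoords V ι)
    (ht : Submodule.span ℂ (Set.range (krausMatrix t).row) = ⊤) :
    Function.Surjective (Φ.cpCoord P t) := by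
  classical
  have hsingle : ∀ (r : ι) (s : Fin N) (i j : Fin n),
      (Pi.single (r, s) (matUnit i j) : ι × Fin N → MatAlg n) ∈ (Φ.cpCoord P t).range := by
    intro r s i j
    -- The coefficients `c` write the unit vector at `s` as a combination of rows. They are
    -- conjugated in the witness because `t_s` enters the coordinates through its adjoint.
    obtain ⟨c, hc⟩ := (Submodule.mem_span_range_iff_exists_fun ℂ).mp
      (ht ▸ Submodule.mem_top : (Pi.single s 1 : Fin N → ℂ) ∈ _)
    choose v hv using fun p => Φ.surjective (Pi.single r (matUnit i p))
    refine ⟨∑ p : Fin n × Fin n, star (c p) • PreCorr.cpTmul P (v p.2) (matUnit p.1 j), ?_⟩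
    funext ⟨r', s'⟩
    have hc' : ∑ p : Fin n × Fin n, star (c p) * star (t s' p.1 p.2) =
        star ((Pi.single s 1 : Fin N → ℂ) s') := by
      rw [← hc, Finset.sum_apply, star_sum]
      exact Finset.sum_congr rfl fun p _ => (star_mul' _ _).symm
    have hm : ∀ p q : Fin n, matUnit i p * star (t s') * matUnit q j =
        star (t s' q p) • matUnit i j := by
      intro p q
      ext k l
      simp [CStarMatrix.mul_apply, matUnit_entry, CStarMatrix.star_apply, ite_and]
      split_ifs <;> simp
    rw [map_sum, Finset.sum_apply]
    simp only [map_smul, Pi.smul_apply, cpCoord_tmul, hv]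
    rcases eq_or_ne r' r with rfl | hr
    · simp only [Pi.single_eq_same, hm, smul_smul, ← Finset.sum_smul, hc']
      rcases eq_or_ne s' s with rfl | hs
      · simp
      · rw [Pi.single_eq_of_ne hs, Pi.single_eq_of_ne (by simpa using hs)]
        simp
    · rw [Pi.single_eq_of_ne (by simp [hr])]
      simp [Pi.single_eq_of_ne hr]
  rw [← LinearMap.range_eq_top, eq_top_iff]
  rintro f -
  have hf : f = ∑ x : ι × Fin N, ∑ i, ∑ j, f x i j • Pi.single x (matUnit i j) := by
    funext x
    ext k l
    rw [Finset.sum_apply, CStarMatrix.sum_entry, Finset.sum_eq_single x]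
    · simp [CStarMatrix.sum_entry, matUnit_entry, ite_and]
    · intro y _ hy
      simp [Pi.single_eq_of_ne hy.symm]
    · simp
  rw [hf]
  exact Submodule.sum_mem _ fun x _ => Submodule.sum_mem _ fun i _ => Submodule.sum_mem _
    fun j _ => Submodule.smul_mem _ _ (hsingle x.1 x.2 i j)

/-- The coordinates `v ⊗ c ↦ (v_r t_s* c)_{r,s}` of `V ⊗_P M_n(ℂ)`, for `P(a) = ∑ t_s a t_s*`. -/
def cpTensor (Φ : MatrixCoords V ι) (hP : IsKraus P t)
    (ht : Submodule.span ℂ (Set.range (krausMatrix t).row) = ⊤) :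
    MatrixCoords (V.cpTensor P) (ι × Fin N) where
  coord := Φ.cpCoord P t
  coord_left a x rs := by
    induction x using PreCorr.cpTensor_induction with
    | zero => simp
    | add x y hx hy => simp only [map_add, Pi.add_apply, hx, hy, mul_add]
    | tmul v c =>
      refine (Φ.cpCoord_tmul P t (V.left a v) c rs).trans ?_
      rw [Φ.coord_left]
      simp only [cpCoord_tmul, mul_assoc]
  coord_right a x rs := by
    induction x using PreCorr.cpTensor_induction with
    | zero => simp
    | add x y hx hy => simp only [map_add, Pi.add_apply, hx, hy, add_mul]
    | tmul v c =>
      refine (Φ.cpCoord_tmul P t v (c * a) rs).trans ?_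
      rw [cpCoord_tmul, mul_assoc _ c a]
  form_eq x y := by
    induction x using PreCorr.cpTensor_induction with
    | zero => simp
    | add x y hx hy =>
      simp only [map_add, LinearMap.add_apply, Pi.add_apply, hx, hy, star_add, add_mul,
        Finset.sum_add_distrib]
    | tmul v c =>
      induction y using PreCorr.cpTensor_induction with
      | zero => simp
      | add x y hx hy =>
        simp only [map_add, Pi.add_apply, hx, hy, mul_add, Finset.sum_add_distrib]
      | tmul v' c' =>
        refine (PreCorr.cpTensor_form_tmul V P v v' c c').trans ?_
        -- Expanding `P` in Kraus form turns `c* P(∑ v_r* v'_r) c'` into `∑ (v_r t_s* c)* (v'_r t_s*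
        -- c')`.
        simp only [cpCoord_tmul, hP _, Φ.form_eq, Fintype.sum_prod_type, star_mul, star_star,
          Finset.mul_sum, Finset.sum_mul, mul_assoc]
        exact Finset.sum_comm
  surjective := Φ.cpCoord_surjective ht

end CPTensor

end MatrixCoords

end Coordinates

/-! ### Recognizing the Hilbert space quotient of a semi-inner product space. -/

section Hilb

/-- A form-preserving linear surjection onto an inner product space identifies that space with the
quotient by the null vectors. -/
theorem PreCorr.exists_hilb_isometryEquiv (V : PreCorr ℂ ℂ) {H : Type} [NormedAddCommGroup H]
    [InnerProductSpace ℂ H] (L : V.carrier →ₗ[ℂ] H)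
    (hL : ∀ v w, inner ℂ (L v) (L w) = V.form v w) (hs : Function.Surjective L) :
    ∃ U : V.Hilb ≃ₗᵢ[ℂ] H, ∀ v, U (V.hilbMk v) = L v := by
  let L' : V.Hilb →ₗ[ℂ] H := V.null.liftQ L fun x hx =>
    inner_self_eq_zero.mp ((hL x x).trans hx)
  have hL' : ∀ x y : V.Hilb, inner ℂ (L' x) (L' y) = inner ℂ x y := by
    intro x y
    induction x using Submodule.Quotient.induction_on with | H x =>
    induction y using Submodule.Quotient.induction_on with | H y =>
    exact hL x y
  have hs' : Function.Surjective L' := fun z => by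
    obtain ⟨x, hx⟩ := hs z
    exact ⟨V.hilbMk x, hx⟩
  exact ⟨LinearIsometryEquiv.ofSurjective (L'.isometryOfInner hL') hs', fun v => rfl⟩

end Hilb

/-! ### The compression of `M_n(ℂ)^ι`. -/

section Compression

variable {n : ℕ}

theorem colSpace_left_apply (a : MatAlg n) (η : Fin n → ℂ) :
    (colSpace n).left a η = fun i => ∑ j, a i j * η j := rfl

theorem colSpace_form_apply (η η' : Fin n → ℂ) :
    (colSpace n).form η η' = ∑ i, star (η i) * η' i := rfl

theorem rowSpace_form_apply (ξ ξ' : Fin n → ℂ) (i j : Fin n) :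
    (rowSpace n).form ξ ξ' i j = star (ξ i) * ξ' j := rfl

/-- This is associativity, `(ξ ζ)* (ξ' ζ') = ζ* (ξ* ξ') ζ'`, and it serves one coordinate `r` at a
time with `ζ = x_r η`. -/
theorem inner_sum_mul_eq_colSpace_form (ξ ξ' ζ ζ' : Fin n → ℂ) :
    inner ℂ (∑ i, ξ i * ζ i) (∑ i, ξ' i * ζ' i) =
      (colSpace n).form ζ ((colSpace n).left ((rowSpace n).form ξ ξ') ζ') := by
  have h : (colSpace n).left ((rowSpace n).form ξ ξ') ζ' =
      fun i => star (ξ i) * ∑ j, ξ' j * ζ' j := by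
    rw [colSpace_left_apply]
    funext i
    rw [Finset.mul_sum]
    exact Finset.sum_congr rfl fun j _ => by rw [rowSpace_form_apply, mul_assoc]
  rw [h, colSpace_form_apply, RCLike.inner_apply, mul_comm, map_sum, Finset.sum_mul]
  refine Finset.sum_congr rfl fun i _ => ?_
  rw [map_mul, starRingEnd_apply, starRingEnd_apply, mul_comm (star (ξ i)), mul_assoc]

namespace MatrixCoords

variable {E : Corr (MatAlg n) (MatAlg n)} {ι : Type} [Fintype ι]

/-- The map `ξ ⊗ x ⊗ η ↦ (ξ x_r η)_r`. -/
def compressionCoord (Φ : MatrixCoords E.toPreCorr ι) :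
    (((rowSpace n).tensor E.toPreCorr).tensor (colSpace n)).carrier →ₗ[ℂ] EuclideanSpace ℂ ι :=
  show (((Fin n → ℂ) ⊗[ℂ] E.carrier) ⊗[ℂ] (Fin n → ℂ)) →ₗ[ℂ] EuclideanSpace ℂ ι from
    TensorProduct.lift (TensorProduct.lift
      { toFun := fun ξ => LinearMap.mk₂ ℂ
          (fun x η => WithLp.toLp 2 fun r => ∑ i, ξ i * ∑ j, Φ.coord x r i j * η j)
          (fun x y η => by ext r; simp [add_mul, mul_add, Finset.sum_add_distrib])
          (fun c x η => by ext r; simp [Finset.mul_sum, mul_assoc, mul_left_comm])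
          (fun x η η' => by ext r; simp [mul_add, Finset.sum_add_distrib])
          (fun c x η => by ext r; simp [Finset.mul_sum, mul_left_comm])
        map_add' := fun ξ ξ' => by ext; simp [add_mul, Finset.sum_add_distrib]
        map_smul' := fun c ξ => by ext; simp [Finset.mul_sum, mul_assoc] })

theorem compressionCoord_tmul (Φ : MatrixCoords E.toPreCorr ι) (ξ : Fin n → ℂ) (x : E.carrier)
    (η : Fin n → ℂ) (r : ι) :
    Φ.compressionCoord (PreCorr.tmul (V := (rowSpace n).tensor E.toPreCorr) (W := colSpace n)
      (PreCorr.tmul (V := rowSpace n) (W := E.toPreCorr) ξ x) η) r =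
      ∑ i, ξ i * (colSpace n).left (Φ.coord x r) η i := rfl

/-- By sesquilinearity elementary tensors suffice. There the form is `∑ η* x_r* (ξ* ξ') x'_r η'`,
whose summands are the inner products of the numbers `ξ x_r η` and `ξ' x'_r η'`. -/
theorem inner_compressionCoord (Φ : MatrixCoords E.toPreCorr ι)
    (v w : (((rowSpace n).tensor E.toPreCorr).tensor (colSpace n)).carrier) :
    inner ℂ (Φ.compressionCoord v) (Φ.compressionCoord w) =
      (((rowSpace n).tensor E.toPreCorr).tensor (colSpace n)).form v w := by
  induction v using PreCorr.tensor_induction with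
  | zero => simp
  | add v v' hv hv' => rw [map_add, map_add, LinearMap.add_apply, inner_add_left, hv, hv']
  | tmul u η =>
  induction w using PreCorr.tensor_induction with
  | zero => simp
  | add w w' hw hw' => rw [map_add, map_add, inner_add_right, hw, hw']
  | tmul u' η' =>
  rw [PreCorr.tensor_form_tmul]
  induction u using PreCorr.tensor_induction with
  | zero =>
    rw [show PreCorr.tmul (0 : ((rowSpace n).tensor E.toPreCorr).carrier) η = 0 from
      TensorProduct.zero_tmul _ _]
    simp
  | add v v' hv hv' =>
    rw [show PreCorr.tmul (v + v') η = PreCorr.tmul v η + PreCorr.tmul v' η from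
      TensorProduct.add_tmul _ _ _, map_add, map_add, LinearMap.add_apply, inner_add_left, hv,
      hv', map_add, LinearMap.add_apply, map_add]
  | tmul ξ x =>
  induction u' using PreCorr.tensor_induction with
  | zero =>
    rw [show PreCorr.tmul (0 : ((rowSpace n).tensor E.toPreCorr).carrier) η' = 0 from
      TensorProduct.zero_tmul _ _]
    simp
  | add v v' hv hv' =>
    rw [show PreCorr.tmul (v + v') η' = PreCorr.tmul v η' + PreCorr.tmul v' η' from
      TensorProduct.add_tmul _ _ _, map_add, inner_add_right, hv, hv', map_add, map_add,
      LinearMap.add_apply, map_add]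
  | tmul ξ' x' =>
  rw [PreCorr.tensor_form_tmul, Φ.form_eq, map_sum, LinearMap.sum_apply, map_sum,
    PiLp.inner_apply]
  refine Finset.sum_congr rfl fun r _ => ?_
  -- The factor `x_r*` moves to the other side of the form, where it acts on `η` as `x_r`.
  rw [Φ.coord_left, map_mul, Module.End.mul_apply, ← (colSpace n).form_left, map_mul,
    Module.End.mul_apply]
  refine (congrArg₂ (inner ℂ) (Φ.compressionCoord_tmul ξ x η r)
    (Φ.compressionCoord_tmul ξ' x' η' r)).trans ?_
  exact inner_sum_mul_eq_colSpace_form ξ ξ' _ _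

theorem compressionCoord_surjective [NeZero n] (Φ : MatrixCoords E.toPreCorr ι) :
    Function.Surjective Φ.compressionCoord := by
  intro v
  -- Scalar matrices `v_r I` give `e_0 (v_r I) e_0* = v_r`; the index `0` exists because `n ≥ 1`.
  obtain ⟨x, hx⟩ := Φ.surjective fun r => v r • 1
  refine ⟨PreCorr.tmul (V := (rowSpace n).tensor E.toPreCorr) (W := colSpace n)
    (PreCorr.tmul (V := rowSpace n) (W := E.toPreCorr) (Pi.single 0 1) x) (Pi.single 0 1), ?_⟩
  ext r
  have h : (colSpace n).left (v r • 1) (Pi.single 0 1 : Fin n → ℂ) =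
      fun i => v r * (Pi.single 0 1 : Fin n → ℂ) i := by
    rw [map_smul, map_one]
    rfl
  rw [compressionCoord_tmul, hx, h]
  simp [Pi.single_apply]

/-- The compression of `M_n(ℂ)^ι` is `ℂ^ι`. -/
theorem exists_compression_isometryEquiv [NeZero n] (Φ : MatrixCoords E.toPreCorr ι) :
    ∃ U : Compression E ≃ₗᵢ[ℂ] EuclideanSpace ℂ ι, ∀ ξ x η r,
      U (Compression.mk E ξ x η) r = ∑ i, ξ i * ∑ j, Φ.coord x r i j * η j := by
  obtain ⟨U, hU⟩ := PreCorr.exists_hilb_isometryEquiv _ Φ.compressionCoord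
    Φ.inner_compressionCoord Φ.compressionCoord_surjective
  refine ⟨U, fun ξ x η r => ?_⟩
  exact congrArg (fun z : EuclideanSpace ℂ ι => z r) (hU _)

end MatrixCoords

end Compression

/-! ### Strong Morita equivalence of `M_n(ℂ)^ι` and `ℂ^ι` through the column space. -/

section Morita

variable {n : ℕ}

/-- The composite of `j` with the quotient map is onto, so the density condition holds with distance
zero. -/
theorem PreCorr.isCompletion_toCorr {A B : Type} [CStarAlgebra A] [PartialOrder A]
    [StarOrderedRing A] [CStarAlgebra B] [PartialOrder B] [StarOrderedRing B]
    {V W : PreCorr A B} [FiniteDimensional ℂ W.carrier] (j : V.carrier →ₗ[ℂ] W.carrier)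
    (hl : ∀ a v, j (V.left a v) = W.left a (j v)) (hr : ∀ b v, j (V.right b v) = W.right b (j v))
    (hf : ∀ v w, W.form (j v) (j w) = V.form v w) (hs : Function.Surjective j) :
    V.IsCompletion W.toCorr := by
  refine ⟨W.null.mkQ ∘ₗ j, fun a v => ?_, fun b v => ?_, hf, fun z ε hε => ?_⟩
  · exact congrArg W.null.mkQ (hl a v)
  · exact congrArg W.null.mkQ (hr b v)
  · obtain ⟨w, rfl⟩ := W.null.mkQ_surjective z
    obtain ⟨v, rfl⟩ := hs w
    refine ⟨v, ?_⟩
    have h : W.null.mkQ (j v) - W.null.mkQ (j v) = 0 := sub_self _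
    refine (congrArg (fun x : W.sep.carrier => ‖W.sep.form x x‖) h).trans_lt ?_
    have h0 : W.sep.form (0 : W.sep.carrier) (0 : W.sep.carrier) = 0 := map_zero _
    exact (congrArg norm h0).trans_lt (norm_zero.trans_lt hε)

theorem colSpace_definite (v : Fin n → ℂ) (h : (colSpace n).form v v = 0) : v = 0 := by
  rw [colSpace_form_apply] at h
  funext i
  have h' := (Finset.sum_eq_zero_iff_of_nonneg
    fun i _ => star_mul_self_nonneg (v i)).mp h i (Finset.mem_univ i)
  exact (CStarRing.star_mul_self_eq_zero_iff _).mp h'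

/-- The `M_n(ℂ)`-valued inner product `η η'*` of column vectors. -/
def colLeftForm (n : ℕ) : (Fin n → ℂ) →ₗ[ℂ] (Fin n → ℂ) →ₗ⋆[ℂ] MatAlg n :=
  LinearMap.mk₂'ₛₗ (RingHom.id ℂ) (starRingEnd ℂ)
    (fun η η' : Fin n → ℂ => (CStarMatrix.ofMatrix fun i j => η i * star (η' j) : MatAlg n))
    (fun a b η => by ext i j; simp [CStarMatrix.ofMatrix_entry, add_mul])
    (fun c a η => by ext i j; simp [CStarMatrix.ofMatrix_entry, mul_assoc])
    (fun a η η' => by ext i j; simp [CStarMatrix.ofMatrix_entry, mul_add])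
    (fun c a η => by ext i j; simp [CStarMatrix.ofMatrix_entry, mul_left_comm])

/-- The column space as an equivalence bimodule between `M_n(ℂ)` and `ℂ`, with
`⟨η, η'⟩ = η η'*` on the left. -/
def colEquivBimodule (n : ℕ) [NeZero n] : EquivBimodule (MatAlg n) ℂ :=
  have : FiniteDimensional ℂ (colSpace n).carrier :=
    inferInstanceAs (FiniteDimensional ℂ (Fin n → ℂ))
  { toPreCorr := colSpace n
    definite := colSpace_definite
    complete := (colSpace n).complete_of_finite colSpace_definite
    leftForm := colLeftForm n
    leftForm_left := fun a x y => by
      ext i j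
      rw [CStarMatrix.mul_apply]
      refine (Finset.sum_mul _ _ _).trans (Finset.sum_congr rfl fun k _ => ?_)
      exact mul_assoc _ _ _
    leftForm_star := fun x y => by
      ext i j
      rw [CStarMatrix.star_apply]
      refine (star_mul' _ _).trans ?_
      rw [star_star]
      exact mul_comm _ _
    leftForm_right := fun b x y => by
      ext i j
      change b * x i * star (y j) = x i * star (star b * y j)
      rw [star_mul', star_star]
      ring
    leftForm_nonneg := fun x => by
      refine CStarMatrix.nonneg_of_forall _ (fun i j => ?_) fun a => ?_
      · refine (star_mul' _ _).trans ?_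
        rw [star_star]
        exact mul_comm _ _
      -- Positivity of `x x*` comes from `a* x x* a = |x* a|²`.
      · have h : ∑ i, ∑ j, star (a i) * (x i * star (x j)) * a j
            = star (∑ i, star (x i) * a i) * ∑ i, star (x i) * a i := by
          rw [star_sum, Finset.sum_mul_sum]
          refine Finset.sum_congr rfl fun i _ => Finset.sum_congr rfl fun j _ => ?_
          rw [star_mul', star_star]
          ring
        exact h ▸ star_mul_self_nonneg (∑ i, star (x i) * a i)
    leftForm_definite := fun x h => by
      funext i
      have h' : x i * star (x i) = 0 := congrFun (congrFun h i) i
      exact (CStarRing.mul_star_self_eq_zero_iff _).mp h'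
    assoc := fun x y z => by
      funext i
      change ∑ j, x i * star (y j) * z j = (∑ j, star (y j) * z j) * x i
      rw [Finset.sum_mul]
      exact Finset.sum_congr rfl fun j _ => by ring
    full_right := by
      -- A standard unit vector, available since `n ≥ 1`, has inner product `1` with itself.
      have h : (1 : ℂ) ∈ {b : ℂ | ∃ x y, (colSpace n).form x y = b} :=
        ⟨Pi.single (0 : Fin n) (1 : ℂ), Pi.single (0 : Fin n) (1 : ℂ), by
          rw [colSpace_form_apply]; simp [Pi.single_apply]⟩
      have ht : Submodule.span ℂ {b : ℂ | ∃ x y, (colSpace n).form x y = b} = ⊤ := by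
        refine eq_top_iff.mpr fun z _ => ?_
        have := Submodule.smul_mem _ z (Submodule.subset_span h)
        rwa [smul_eq_mul, mul_one] at this
      rw [ht]
      exact dense_univ
    full_left := by
      -- The span is already everything, because the left inner product of two standard columns is
      -- the matrix unit `e_{ij}`.
      refine Dense.mono (s₁ := Set.univ) (fun a _ => ?_) dense_univ
      have ha : a = ∑ i, ∑ j, a i j • matUnit i j := by
        ext p q
        simp only [CStarMatrix.sum_entry, CStarMatrix.smul_apply, matUnit_entry]
        simp [ite_and]
      rw [ha]
      refine Submodule.sum_mem _ fun i _ => Submodule.sum_mem _ fun j _ =>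
        Submodule.smul_mem _ _ (Submodule.subset_span
          ⟨Pi.single i (1 : ℂ), Pi.single j (1 : ℂ), ?_⟩)
      ext p q
      rw [matUnit_entry]
      change (Pi.single i (1 : ℂ) : Fin n → ℂ) p * star ((Pi.single j (1 : ℂ) : Fin n → ℂ) q) = _
      simp only [Pi.single_apply, ite_and, eq_comm (a := p), eq_comm (a := q)]
      split_ifs <;> simp }

namespace MatrixCoords

variable {E : Corr (MatAlg n) (MatAlg n)} {ι : Type} [Fintype ι] [DecidableEq ι]

/-- The map `x ⊗ η ↦ ∑ x_r η ⊗ e_r`. -/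
def colCoord (Φ : MatrixCoords E.toPreCorr ι) :
    (E.tensor (colSpace n)).carrier →ₗ[ℂ]
      ((colSpace n).tensor (Corr.ofHilbert (EuclideanSpace ℂ ι)).toPreCorr).carrier :=
  show (E.carrier ⊗[ℂ] (Fin n → ℂ)) →ₗ[ℂ] (Fin n → ℂ) ⊗[ℂ] EuclideanSpace ℂ ι from
    TensorProduct.lift (LinearMap.mk₂ ℂ
      (fun x η => ∑ r, (show Fin n → ℂ from (colSpace n).left (Φ.coord x r) η) ⊗ₜ[ℂ]
        EuclideanSpace.single r (1 : ℂ))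
      (fun x y η => by
        rw [← Finset.sum_add_distrib]
        refine Finset.sum_congr rfl fun r _ => ?_
        rw [← TensorProduct.add_tmul, map_add, Pi.add_apply, map_add]
        rfl)
      (fun c x η => by
        rw [Finset.smul_sum]
        refine Finset.sum_congr rfl fun r _ => ?_
        rw [TensorProduct.smul_tmul', map_smul, Pi.smul_apply, map_smul]
        rfl)
      (fun x η η' => by
        rw [← Finset.sum_add_distrib]
        refine Finset.sum_congr rfl fun r _ => ?_
        rw [← TensorProduct.add_tmul]
        exact congrArg (· ⊗ₜ[ℂ] _) (map_add ((colSpace n).left (Φ.coord x r)) η η'))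
      (fun c x η => by
        rw [Finset.smul_sum]
        refine Finset.sum_congr rfl fun r _ => ?_
        rw [TensorProduct.smul_tmul']
        exact congrArg (· ⊗ₜ[ℂ] _) (map_smul ((colSpace n).left (Φ.coord x r)) c η)))

theorem colCoord_tmul (Φ : MatrixCoords E.toPreCorr ι) (x : E.carrier)
    (η : (colSpace n).carrier) :
    Φ.colCoord (PreCorr.tmul x η) = ∑ r, PreCorr.tmul ((colSpace n).left (Φ.coord x r) η)
      (show (Corr.ofHilbert (EuclideanSpace ℂ ι)).carrier from EuclideanSpace.single r (1 : ℂ)) :=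
  rfl

/-- Orthonormality of the `e_r` removes the cross terms, leaving `∑ (x_r η)* (x'_r η') = η* (∑ x_r*
x'_r) η'`. -/
theorem form_colCoord (Φ : MatrixCoords E.toPreCorr ι) (v w : (E.tensor (colSpace n)).carrier) :
    ((colSpace n).tensor (Corr.ofHilbert (EuclideanSpace ℂ ι)).toPreCorr).form (Φ.colCoord v)
      (Φ.colCoord w) = (E.tensor (colSpace n)).form v w := by
  induction v using PreCorr.tensor_induction with
  | zero => simp
  | add v v' hv hv' => simp only [map_add, LinearMap.add_apply, hv, hv']
  | tmul x η =>
  induction w using PreCorr.tensor_induction with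
  | zero => simp
  | add w w' hw hw' => simp only [map_add, hw, hw']
  | tmul x' η' =>
  have hF : ∀ (r s : ι) (c : ℂ), (Corr.ofHilbert (EuclideanSpace ℂ ι)).form
      (EuclideanSpace.single r (1 : ℂ))
      ((Corr.ofHilbert (EuclideanSpace ℂ ι)).left c (EuclideanSpace.single s (1 : ℂ))) =
      if r = s then c else 0 := by
    intro r s c
    change inner ℂ (EuclideanSpace.single r (1 : ℂ)) (c • EuclideanSpace.single s (1 : ℂ)) = _
    rw [inner_smul_right, EuclideanSpace.inner_single_left]
    simp
  rw [PreCorr.tensor_form_tmul, colCoord_tmul, colCoord_tmul, Φ.form_eq]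
  simp only [map_sum, LinearMap.sum_apply]
  refine Finset.sum_congr rfl fun r _ => ?_
  rw [map_mul, Module.End.mul_apply, ← (colSpace n).form_left]
  rw [Finset.sum_eq_single r]
  · refine (PreCorr.tensor_form_tmul _ _ _ _ _ _).trans ?_
    exact (hF r r _).trans (if_pos rfl)
  · intro s _ hs
    refine (PreCorr.tensor_form_tmul _ _ _ _ _ _).trans ?_
    exact (hF _ _ _).trans (if_neg hs)
  · simp

/-- If `x` has coordinates `v_r I`, then `x ⊗ η` goes to `∑ v_r η ⊗ e_r = η ⊗ v`, and such tensors
span. -/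
theorem colCoord_surjective (Φ : MatrixCoords E.toPreCorr ι) :
    Function.Surjective Φ.colCoord := by
  rw [← LinearMap.range_eq_top, eq_top_iff]
  rintro z -
  induction z using PreCorr.tensor_induction with
  | zero => exact Submodule.zero_mem _
  | add z z' hz hz' => exact Submodule.add_mem _ hz hz'
  | tmul η v =>
    let v' : EuclideanSpace ℂ ι := v
    obtain ⟨x, hx⟩ := Φ.surjective fun r => v' r • 1
    refine ⟨PreCorr.tmul x η, ?_⟩
    rw [colCoord_tmul, hx]
    have hv : v' = ∑ r, v' r • EuclideanSpace.single r (1 : ℂ) := by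
      ext s
      simp [Finset.sum_apply, Pi.single_apply]
    have h : (show Fin n → ℂ from η) ⊗ₜ[ℂ] v' = ∑ r, (v' r • (show Fin n → ℂ from η)) ⊗ₜ[ℂ]
        EuclideanSpace.single r (1 : ℂ) := by
      conv_lhs => rw [hv]
      rw [TensorProduct.tmul_sum]
      exact Finset.sum_congr rfl fun r _ => (TensorProduct.smul_tmul _ _ _).symm
    refine Eq.trans (Finset.sum_congr rfl fun r _ => ?_) h.symm
    rw [map_smul, map_one]
    rfl

theorem colCoord_left (Φ : MatrixCoords E.toPreCorr ι) (a : MatAlg n)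
    (v : (E.tensor (colSpace n)).carrier) :
    Φ.colCoord ((E.tensor (colSpace n)).left a v) =
      ((colSpace n).tensor (Corr.ofHilbert (EuclideanSpace ℂ ι)).toPreCorr).left a
        (Φ.colCoord v) := by
  induction v using PreCorr.tensor_induction with
  | zero => simp
  | add v v' hv hv' => simp only [map_add, hv, hv']
  | tmul x η =>
    refine (Φ.colCoord_tmul (E.left a x) η).trans ?_
    rw [Φ.colCoord_tmul x η, map_sum]
    refine Finset.sum_congr rfl fun r _ => ?_
    rw [Φ.coord_left, map_mul]
    rfl

/-- The scalar acts on the column factor in the source and on the factor `ℂ^ι` in the target; it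
moves across the tensor product over `ℂ`. -/
theorem colCoord_right (Φ : MatrixCoords E.toPreCorr ι) (b : ℂᵐᵒᵖ)
    (v : (E.tensor (colSpace n)).carrier) :
    Φ.colCoord ((E.tensor (colSpace n)).right b v) =
      ((colSpace n).tensor (Corr.ofHilbert (EuclideanSpace ℂ ι)).toPreCorr).right b
        (Φ.colCoord v) := by
  induction v using PreCorr.tensor_induction with
  | zero => simp
  | add v v' hv hv' => simp only [map_add, hv, hv']
  | tmul x η =>
    refine (Φ.colCoord_tmul x ((colSpace n).right b η)).trans ?_
    rw [Φ.colCoord_tmul x η, map_sum]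
    refine Finset.sum_congr rfl fun r _ => ?_
    rw [(colSpace n).left_right (Φ.coord x r) b η]
    exact TensorProduct.smul_tmul (R := ℂ) b.unop
      (show Fin n → ℂ from (colSpace n).left (Φ.coord x r) η) (EuclideanSpace.single r (1 : ℂ))

/-- `M_n(ℂ)^ι` is strongly Morita equivalent to `ℂ^ι`. -/
theorem stronglyMoritaEquivalent [NeZero n] (Φ : MatrixCoords E.toPreCorr ι) :
    StronglyMoritaEquivalent E (Corr.ofHilbert (EuclideanSpace ℂ ι)) := by
  let W := (colSpace n).tensor (Corr.ofHilbert (EuclideanSpace ℂ ι)).toPreCorr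
  have : FiniteDimensional ℂ W.carrier :=
    inferInstanceAs (FiniteDimensional ℂ ((Fin n → ℂ) ⊗[ℂ] EuclideanSpace ℂ ι))
  -- The common completion is `C_n ⊗ ℂ^ι` modulo null vectors, so only the map out of `E ⊗ C_n`
  -- needs an argument.
  exact ⟨colEquivBimodule n, W.toCorr,
    PreCorr.isCompletion_toCorr (W := W) Φ.colCoord Φ.colCoord_left Φ.colCoord_right
      Φ.form_colCoord Φ.colCoord_surjective,
    PreCorr.isCompletion_toCorr (W := W) LinearMap.id (fun _ _ => rfl) (fun _ _ => rfl)
      (fun _ _ => rfl) Function.surjective_id⟩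

end MatrixCoords

end Morita

/-! ### Coordinates of the GNS correspondences and the unitary `U`. -/

section GNS

variable {n N N' : ℕ} {P₁ P₂ : MatAlg n →CP MatAlg n} {t : Fin N → MatAlg n}
  {s : Fin N' → MatAlg n}

/-- The coordinates `a ⊗ b ↦ (a t_r* b)_r` of `E_P`. -/
def MatrixCoords.gns (hP : IsKraus P₁ t)
    (ht : Submodule.span ℂ (Set.range (krausMatrix t).row) = ⊤) :
    MatrixCoords (gns P₁).toPreCorr (Fin N) :=
  -- `M_n(ℂ)` has a single coordinate over itself; reindexing drops this one-point factor.
  (((MatrixCoords.self n).cpTensor hP ht).reindex (Equiv.punitProd (Fin N)).symm).sep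

/-- The coordinates `a ⊗ b ⊗ c ↦ (a t_r* b u_s* c)_{r,s}` of `E_{P₁P₂}`. -/
def MatrixCoords.gns₂ (hP₁ : IsKraus P₁ t)
    (ht : Submodule.span ℂ (Set.range (krausMatrix t).row) = ⊤) (hP₂ : IsKraus P₂ s)
    (hs : Submodule.span ℂ (Set.range (krausMatrix s).row) = ⊤) :
    MatrixCoords (gns₂ P₁ P₂).toPreCorr (Fin N × Fin N') :=
  ((((MatrixCoords.self n).cpTensor hP₁ ht).reindex
    (Equiv.punitProd (Fin N)).symm).cpTensor hP₂ hs).sep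

theorem MatrixCoords.gns_coord_mk (hP : IsKraus P₁ t)
    (ht : Submodule.span ℂ (Set.range (krausMatrix t).row) = ⊤) (a b : MatAlg n) (r : Fin N) :
    (MatrixCoords.gns hP ht).coord (gns.mk P₁ a b) r = a * star (t r) * b := rfl

theorem MatrixCoords.gns₂_coord_mk (hP₁ : IsKraus P₁ t)
    (ht : Submodule.span ℂ (Set.range (krausMatrix t).row) = ⊤) (hP₂ : IsKraus P₂ s)
    (hs : Submodule.span ℂ (Set.range (krausMatrix s).row) = ⊤) (a b c : MatAlg n)
    (r : Fin N × Fin N') :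
    (MatrixCoords.gns₂ hP₁ ht hP₂ hs).coord (gns₂.mk P₁ P₂ a b c) r =
      a * star (t r.1) * b * star (s r.2) * c := rfl

/-- The unitary `F_{P₁P₂} ≃ F_{P₁} ⊗ F_{P₂}`. -/
theorem exists_compression_gns₂_isometryEquiv [NeZero n] (P₁ P₂ : MatAlg n →CP MatAlg n) :
    ∃ U : Compression (gns₂ P₁ P₂) ≃ₗᵢ[ℂ] Compression (gns P₁) ⊗[ℂ] Compression (gns P₂),
      ∀ i j k l : Fin n,
        U (Compression.mk (gns₂ P₁ P₂) (Pi.single j 1) (gns₂.mk P₁ P₂ 1 (matUnit k l) 1)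
            (Pi.single i 1)) =
          Compression.mk (gns P₁) (Pi.single j 1) (gns.mk P₁ 1 1) (Pi.single k 1) ⊗ₜ[ℂ]
            Compression.mk (gns P₂) (Pi.single l 1) (gns.mk P₂ 1 1) (Pi.single i 1) := by
  obtain ⟨t, hP₁, ht⟩ := exists_isKraus_span_row P₁
  obtain ⟨s, hP₂, hs⟩ := exists_isKraus_span_row P₂
  obtain ⟨U₁, hU₁⟩ := (MatrixCoords.gns hP₁ ht).exists_compression_isometryEquiv
  obtain ⟨U₂, hU₂⟩ := (MatrixCoords.gns hP₂ hs).exists_compression_isometryEquiv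
  obtain ⟨U, hU⟩ := (MatrixCoords.gns₂ hP₁ ht hP₂ hs).exists_compression_isometryEquiv
  -- The product basis is indexed by the same pairs `(r, q)` as the coordinates of `E_{P₁P₂}`, so
  -- `U` can be composed with its inverse coordinate map.
  let b := (OrthonormalBasis.ofRepr U₁).tensorProduct (OrthonormalBasis.ofRepr U₂)
  refine ⟨U.trans b.repr.symm, fun i j k l => ?_⟩
  rw [LinearIsometryEquiv.trans_apply, LinearIsometryEquiv.symm_apply_eq]
  ext ⟨r, q⟩
  rw [OrthonormalBasis.tensorProduct_repr_tmul_apply]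
  change _ = U₂ _ q • U₁ _ r
  rw [hU, hU₁, hU₂]
  simp only [MatrixCoords.gns_coord_mk, MatrixCoords.gns₂_coord_mk, one_mul, mul_one]
  -- Both sides are the product of the `(j, k)` entry of `t_r*` and the `(l, i)` entry of `s_q*`.
  simp [Pi.single_apply, CStarMatrix.mul_apply, matUnit_entry, ite_and, mul_comm]

end GNS

end

theorem mainTheorem3 (n : ℕ) [NeZero n] (P₁ P₂ : MatAlg n →CP MatAlg n) :
    -- the index does not depend on the representation used to compute it
    (∀ (N : ℕ) (t : Fin N → MatAlg n), IsKraus P₁ t →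
      Module.finrank ℂ (Submodule.span ℂ (Set.range t)) = cpIndex P₁) ∧
    (∀ (N : ℕ) (t : Fin N → MatAlg n), IsKraus P₂ t →
      Module.finrank ℂ (Submodule.span ℂ (Set.range t)) = cpIndex P₂) ∧
    -- Morita equivalence
    StronglyMoritaEquivalent (gns₂ P₁ P₂)
      (Corr.ofHilbert (EuclideanSpace ℂ (Fin (cpIndex P₁ * cpIndex P₂)))) ∧
    -- the compression is naturally the Hilbert space tensor product
    ∃ U : Compression (gns₂ P₁ P₂) ≃ₗᵢ[ℂ] Compression (gns P₁) ⊗[ℂ] Compression (gns P₂),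
      ∀ i j k l : Fin n,
        U (Compression.mk (gns₂ P₁ P₂) (Pi.single j 1) (gns₂.mk P₁ P₂ 1 (matUnit k l) 1)
            (Pi.single i 1)) =
          Compression.mk (gns P₁) (Pi.single j 1) (gns.mk P₁ 1 1) (Pi.single k 1) ⊗ₜ[ℂ]
            Compression.mk (gns P₂) (Pi.single l 1) (gns.mk P₂ 1 1) (Pi.single i 1) := by
  obtain ⟨t, hP₁, ht⟩ := exists_isKraus_span_row P₁
  obtain ⟨s, hP₂, hs⟩ := exists_isKraus_span_row P₂
  exact ⟨fun _ _ h => h.finrank_span_eq_cpIndex, fun _ _ h => h.finrank_span_eq_cpIndex,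
    -- Pairs of indices are renumbered by a single index, so that the Hilbert space is literally
    -- `ℂ^(d(P₁)d(P₂))`.
    ((MatrixCoords.gns₂ hP₁ ht hP₂ hs).reindex finProdFinEquiv.symm).stronglyMoritaEquivalent,
    exists_compression_gns₂_isometryEquiv P₁ P₂⟩
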